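/- Let $G$ be a finite connected graph, loops and multiple edges allowed, with fixed total orders on the vertex set $V$ and on the edge set $E$; let $v_0$ be the least vertex. For $S\subseteq E$ let $\mathrm{Conn}(S)$ be the set of connected components of the spanning graph $[G:S]=(V,S)$, and for $e\notin S$ put $\epsilon^{S,e}=(-1)^{|\{e'\in S\,:\,e'<e\}|}$. *The chromatic complex of $G$ (Helme-Guizon and Rong).* $C^{i,j}(G)$ is the free abelian group on the pairs $(S,c)$ with $|S|=i$ and $c:\mathrm{Conn}(S)\to\{1,x\}\subset\mathbb Z[x]/(x^2)$ taking the value $x$ exactly $j$ times, and $d(S,c)=\sum_{e\notin S}\epsilon^{S,e}(S\cup e,c_e)$, where $c_e=c$ if $e$ joins a component to itself, and if $e$ joins two components the new component is labelled by the product of their labels in $\mathbb Z[x]/(x^2)$ (so the term is $0$ if both labels are $x$). Its cohomology is $H^{i,j}(G)$. *The characteristic complex of the graphic matroid $M(G)$ with its canonical quasi-representation.* Let $\tilde N=\bigoplus_{v\in V}\mathbb Z v$, $N=\tilde N/\langle v_0\rangle$, and let $\rho(S)\subseteq N$ be spanned by the classes of $v-v'$ for the edges in $S$ with endpoints $v,v'$.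 Then $C^{i,j}(M(G))=\bigoplus_{|S|=i}\bigwedge^j N/\rho(S)$, and $d$ is the sum over $e\notin S$ of $\epsilon^{S,e}$ times the map induced by $N/\rho(S)\to N/\rho(S\cup e)$. Its cohomology is $H^{i,j}(M(G))$. All groups with $i<0$ or $j<0$ are $0$. For a set $X=\{F_1,\dots,F_k\}\subseteq\mathrm{Conn}(S)$ with $\min V(F_1)<\dots<\min V(F_k)$ let $v_{S,X}=v_{S,F_1}\wedge\dots\wedge v_{S,F_k}\in\bigwedge^k N/\rho(S)$, where $v_{S,F}$ is the class of $\min V(F)$, and let $F_0\in\mathrm{Conn}(S)$ be the component of $v_0$. Let $\theta:C^{i,j}(G)\to C^{i,j}(M(G))$ be the linear map with $\theta(S,c)=v_{S,c^{-1}(x)}$. **Theorem.** There is a linear map $\tau:C^{i,j-1}(M(G))\to C^{i,j}(G)$ (for all $i,j$) with $\tau(v_{S,X})=(S,c)$, $c^{-1}(x)=X\cup\{F_0\}$, if $F_0\notin X$, and $\tau(v_{S,X})=0$ if $F_0\in X$. The sequences of abelian groups $0\to C^{i,j-1}(M(G))\xrightarrow{\tau}C^{i,j}(G)\xrightarrow{\theta}C^{i,j}(M(G))\to0$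 are exact. Moreover, for every $j$ there is a short exact sequence of cochain complexes $$0\to C^{\bullet,j-1}(M(G))\xrightarrow{f}C^{\bullet,j}(G)\xrightarrow{g}C^{\bullet,j}(M(G))\to0$$ with $\operatorname{im} f=\operatorname{im}\tau$ and $\ker g=\ker\theta$ in every degree $i$. With the maps induced by $f$ and $g$ and the connecting homomorphisms of this sequence, there is a long exact sequence $$\cdots\to H^{i,j-1}(M(G))\to H^{i,j}(G)\to H^{i,j}(M(G))\to H^{i+1,j-1}(M(G))\to\cdots.$$ -/

import Mathlib

open CategoryTheory
open scoped Graph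

noncomputable section

/-! ### Cubes of modules and their cochain complexes -/

/-- The sign `ε^{S,e}`: it is `-1` if `#{e' ∈ S | e' < e}` is odd and `1` otherwise. -/
def edgeSign {E : Type*} [LinearOrder E] (S : Finset E) (e : E) : ℤ :=
  (-1) ^ (S.filter (fun e' => e' < e)).card

/-- A commutative cube of graded `R`-modules over the subsets of a finite set `E`: a module for
every subset, a map for every inclusion, and a grading by `j : ℤ` which the maps preserve. -/
structure GradedCube (R : Type*) [CommRing R] (E : Type*) where
  obj : Finset E → Type*
  [addCommGroup : ∀ S, AddCommGroup (obj S)]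
  [module : ∀ S, Module R (obj S)]
  map : ∀ {S T : Finset E}, S ⊆ T → (obj S →ₗ[R] obj T)
  map_map : ∀ {S T U : Finset E} (h : S ⊆ T) (h' : T ⊆ U) (x : obj S),
    map h' (map h x) = map (h.trans h') x
  deg : ∀ (_ : ℤ) (S : Finset E), Submodule R (obj S)
  map_mem : ∀ {S T : Finset E} (h : S ⊆ T) (j : ℤ) (x : obj S), x ∈ deg j S → map h x ∈ deg j T

namespace GradedCube

attribute [instance] GradedCube.addCommGroup GradedCube.module

variable {R : Type*} [CommRing R] {E : Type*} [LinearOrder E]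

/-- The total differential on `⨁_S obj S`. The component of `d x` at `T` is
`∑_{e ∈ T} ε^{T∖e,e} map (x_{T∖e})`; that is, `d` sends `x ∈ obj S` to
`∑_{e ∉ S} ε^{S,e} map_{S ⊆ S∪e} x`. -/
def diff (K : GradedCube R E) : (∀ S, K.obj S) →ₗ[R] (∀ S, K.obj S) :=
  LinearMap.pi fun T => ∑ e ∈ T, edgeSign (T.erase e) e •
    (K.map (T.erase_subset e) ∘ₗ LinearMap.proj (T.erase e))


theorem diff_apply (K : GradedCube R E) (x : ∀ S, K.obj S) (T : Finset E) :
    K.diff x T = ∑ e ∈ T, edgeSign (T.erase e) e • K.map (T.erase_subset e) (x (T.erase e)) := by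
  simp [diff]

theorem edgeSign_swap (T : Finset E) {e f : E} (he : e ∈ T) (hef : e < f) :
    edgeSign (T.erase e) e * edgeSign ((T.erase e).erase f) f =
      -(edgeSign (T.erase f) f * edgeSign ((T.erase f).erase e) e) := by
  have h1 : (T.erase e).filter (fun x => x < e) = ((T.erase f).erase e).filter (fun x => x < e) := by
    ext x
    simp only [Finset.mem_filter, Finset.mem_erase]
    constructor
    · rintro ⟨⟨h1, h2⟩, h3⟩
      exact ⟨⟨h1, (h3.trans hef).ne, h2⟩, h3⟩
    · rintro ⟨⟨h1, -, h2⟩, h3⟩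
      exact ⟨⟨h1, h2⟩, h3⟩
  have h2 : (T.erase f).filter (fun x => x < f) =
      insert e (((T.erase e).erase f).filter (fun x => x < f)) := by
    ext x
    simp only [Finset.mem_filter, Finset.mem_erase, Finset.mem_insert]
    constructor
    · rintro ⟨⟨h1, h2⟩, h3⟩
      by_cases hx : x = e
      · exact Or.inl hx
      · exact Or.inr ⟨⟨h1, hx, h2⟩, h3⟩
    · rintro (rfl | ⟨⟨h1, -, h2⟩, h3⟩)
      · exact ⟨⟨hef.ne, he⟩, hef⟩
      · exact ⟨⟨h1, h2⟩, h3⟩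
  have h3 : e ∉ ((T.erase e).erase f).filter (fun x => x < f) := by simp
  unfold edgeSign
  rw [h1, h2, Finset.card_insert_of_notMem h3, pow_succ]
  ring

theorem map_congr {R E : Type*} [CommRing R] (K : GradedCube R E) (x : ∀ S, K.obj S) {S S' T : Finset E} (hS : S = S')
    (h : S ⊆ T) (h' : S' ⊆ T) : K.map h (x S) = K.map h' (x S') := by
  subst hS
  rfl

theorem diff_diff (K : GradedCube R E) (x : ∀ S, K.obj S) : K.diff (K.diff x) = 0 := by
  funext T
  rw [diff_apply]
  simp only [diff_apply, map_sum, Finset.smul_sum, map_zsmul, K.map_map, smul_smul, Pi.zero_apply]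
  rw [Finset.sum_sigma']
  refine Finset.sum_involution (fun p _ => ⟨p.2, p.1⟩) ?_ ?_ ?_ ?_
  · rintro ⟨e, f⟩ hp
    simp only [Finset.mem_sigma, Finset.mem_erase] at hp
    obtain ⟨he, hfe, hf⟩ := hp
    have hS : (T.erase e).erase f = (T.erase f).erase e := Finset.erase_right_comm
    have hsub : (T.erase e).erase f ⊆ T := (Finset.erase_subset _ _).trans (Finset.erase_subset _ _)
    have hsub' : (T.erase f).erase e ⊆ T :=
      (Finset.erase_subset _ _).trans (Finset.erase_subset _ _)
    have hx := K.map_congr x hS hsub hsub'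
    have hs : edgeSign (T.erase e) e * edgeSign ((T.erase e).erase f) f =
        -(edgeSign (T.erase f) f * edgeSign ((T.erase f).erase e) e) := by
      rcases lt_or_gt_of_ne hfe with h | h
      · rw [edgeSign_swap T hf h, neg_neg]
      · exact edgeSign_swap T he h
    dsimp only
    rw [hx, hs, neg_smul, neg_add_cancel]
  · rintro ⟨e, f⟩ hp - h
    simp only [Finset.mem_sigma, Finset.mem_erase] at hp
    simp only [Sigma.mk.injEq, heq_eq_eq] at h
    exact hp.2.1 h.1
  · rintro ⟨e, f⟩ hp
    simp only [Finset.mem_sigma, Finset.mem_erase] at hp ⊢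
    exact ⟨hp.2.2, hp.2.1.symm, hp.1⟩
  · rintro ⟨e, f⟩ _
    rfl

/-- The chain group `C^{i,j} = ⨁_{#S = i} (obj S)_j`, as a submodule of `⨁_S obj S`. It is zero
if `i` is negative. -/
def chain (K : GradedCube R E) (i j : ℤ) : Submodule R (∀ S, K.obj S) where
  carrier := {x | ∀ S, x S ∈ K.deg j S ∧ ((S.card : ℤ) ≠ i → x S = 0)}
  zero_mem' := fun S => ⟨Submodule.zero_mem _, fun _ => rfl⟩
  add_mem' := fun {x y} hx hy S => ⟨Submodule.add_mem _ (hx S).1 (hy S).1, fun h => by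
    rw [Pi.add_apply, (hx S).2 h, (hy S).2 h, add_zero]⟩
  smul_mem' := fun c x hx S => ⟨Submodule.smul_mem _ _ (hx S).1, fun h => by
    rw [Pi.smul_apply, (hx S).2 h, smul_zero]⟩

theorem diff_mem (K : GradedCube R E) {i i' : ℤ} (h : i + 1 = i') (j : ℤ) :
    ∀ x ∈ K.chain i j, K.diff x ∈ K.chain i' j := by
  intro x hx T
  rw [diff_apply]
  refine ⟨Submodule.sum_mem _ fun e _ => ?_, fun hT => Finset.sum_eq_zero fun e he => ?_⟩
  · exact zsmul_mem (K.map_mem _ _ _ (hx _).1) _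
  · rw [(hx (T.erase e)).2, map_zero, smul_zero]
    have := Finset.card_erase_add_one he
    omega

/-- The cochain complex `C^{•,j}` of a graded cube, for a fixed degree `j`. -/
def complex (K : GradedCube R E) (j : ℤ) : CochainComplex (ModuleCat R) ℤ where
  X i := ModuleCat.of R (K.chain i j)
  d i i' := if h : i + 1 = i' then ModuleCat.ofHom (K.diff.restrict (K.diff_mem h j)) else 0
  shape i i' h := dif_neg h
  d_comp_d' i i' i'' h h' := by
    have h1 : i + 1 = i' := h
    have h2 : i' + 1 = i'' := h'
    rw [dif_pos h1, dif_pos h2]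
    ext x
    exact congrArg (fun y : ∀ S, K.obj S => y _) (K.diff_diff x.1)

end GradedCube

/-! ### Matroids, quasi-representations and the characteristic complex -/

section RankFunction

variable {E : Type*} [Finite E] {r : Set E → ℕ}

theorem rank_union_eq_of_insert (mono : ∀ S T, S ⊆ T → r S ≤ r T)
    (submod : ∀ S T, r (S ∩ T) + r (S ∪ T) ≤ r S + r T) {I : Set E} (J : Set E)
    (h : ∀ e ∈ J, r (insert e I) = r I) : r (I ∪ J) = r I := by
  induction J, J.toFinite using Set.Finite.induction_on with
  | empty => simp
  | @insert e K _ _ ih =>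
    have h1 := ih fun f hf => h f (Set.mem_insert_of_mem _ hf)
    have h2 := h e (Set.mem_insert _ _)
    have h3 := submod (I ∪ K) (insert e I)
    have h4 : (I ∪ K) ∪ insert e I = I ∪ insert e K := by
      ext x
      simp only [Set.mem_union, Set.mem_insert_iff]
      tauto
    have h5 : r I ≤ r ((I ∪ K) ∩ insert e I) :=
      mono _ _ (Set.subset_inter Set.subset_union_left (Set.subset_insert _ _))
    have h6 : r I ≤ r (I ∪ insert e K) := mono _ _ Set.subset_union_left
    rw [h4] at h3
    omega

theorem rank_insert_eq (card : ∀ S, r S ≤ S.ncard) (mono : ∀ S T, S ⊆ T → r S ≤ r T)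
    (submod : ∀ S T, r (S ∩ T) + r (S ∪ T) ≤ r S + r T) {I : Set E} (hI : r I = I.ncard) {e : E}
    (he : e ∉ I) (h : r (insert e I) ≠ (insert e I).ncard) : r (insert e I) = r I := by
  have h1 := submod {e} I
  have h2 := card {e}
  have h3 := mono I (insert e I) (Set.subset_insert _ _)
  rw [Set.ncard_singleton] at h2
  rw [Set.singleton_union] at h1
  rw [Set.ncard_insert_of_notMem he] at h
  omega

/-- The matroid on a finite ground set `E` with a given rank function. -/
def matroidOfRank (r : Set E → ℕ) (card : ∀ S, r S ≤ S.ncard) (mono : ∀ S T, S ⊆ T → r S ≤ r T)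
    (submod : ∀ S T, r (S ∩ T) + r (S ∪ T) ≤ r S + r T) : Matroid E :=
  (IndepMatroid.ofFinite (E := Set.univ) Set.finite_univ (fun I => r I = I.ncard)
    (by simpa using card ∅)
    (by
      intro I J hJ hIJ
      have h1 := submod I (J \ I)
      have h2 := card (J \ I)
      have h3 := card I
      have h4 := Set.ncard_sdiff_add_ncard_of_subset hIJ
      rw [Set.union_sdiff_cancel hIJ] at h1
      omega)
    (by
      intro I J hI hJ hIJ
      by_contra hcon
      push Not at hcon
      have h1 : r (I ∪ J) = r I := rank_union_eq_of_insert mono submod J fun e he => by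
        by_cases heI : e ∈ I
        · rw [Set.insert_eq_of_mem heI]
        · exact rank_insert_eq card mono submod hI heI (hcon e he heI)
      have h2 := mono J (I ∪ J) Set.subset_union_right
      omega)
    (fun _ _ => Set.subset_univ _)).matroid

theorem matroidOfRank_rk (card : ∀ S, r S ≤ S.ncard) (mono : ∀ S T, S ⊆ T → r S ≤ r T)
    (submod : ∀ S T, r (S ∩ T) + r (S ∪ T) ≤ r S + r T) (S : Set E) :
    (matroidOfRank r card mono submod).eRk S = r S := by
  obtain ⟨B, hB⟩ := (matroidOfRank r card mono submod).exists_isBasis S (Set.subset_univ _)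
  have hBi : r B = B.ncard := hB.indep
  rw [← hB.encard_eq_eRk, ← B.toFinite.cast_ncard_eq, ← hBi]
  congr 1
  have h : r (B ∪ S) = r B := rank_union_eq_of_insert mono submod S fun e he => by
    by_cases heB : e ∈ B
    · rw [Set.insert_eq_of_mem heB]
    · refine rank_insert_eq card mono submod hBi heB fun h => heB ?_
      exact hB.mem_of_insert_indep he h
  rw [← h, Set.union_eq_right.2 hB.subset]

end RankFunction

/-- An `R`-quasi-representation, for a principal ideal domain `R`, in the finitely generated
`R`-module `N` of a matroid `M` whose ground set is `E`. -/
structure QuasiRepresentation (R : Type*) [CommRing R] [IsDomain R]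
    [IsPrincipalIdealRing R] (N : Type*) [AddCommGroup N] [Module R N] [Module.Finite R N]
    {E : Type*} (M : Matroid E) where
  ground_eq : M.E = Set.univ
  ρ : Set E → Submodule R N
  finrank_eq : ∀ S, (Module.finrank R (ρ S) : ℕ∞) = M.eRk S
  empty : ρ ∅ = ⊥
  univ : ρ Set.univ = ⊤
  mono : ∀ {S T}, S ⊆ T → ρ S ≤ ρ T
  eq_of_rank_eq : ∀ {S T}, S ⊆ T → M.eRk S = M.eRk T → ρ S = ρ T

/-- The degree `j` part of an exterior algebra, for `j : ℤ`; it is zero for negative `j`. -/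
def exteriorDegree (R : Type*) [CommRing R] (N : Type*) [AddCommGroup N] [Module R N] :
    ℤ → Submodule R (ExteriorAlgebra R N)
  | Int.ofNat n => ⋀[R]^n N
  | Int.negSucc _ => ⊥

theorem exteriorDegree_map {R : Type*} [CommRing R] {N N' : Type*} [AddCommGroup N] [Module R N]
    [AddCommGroup N'] [Module R N'] (φ : N →ₗ[R] N') (j : ℤ) (x : ExteriorAlgebra R N)
    (hx : x ∈ exteriorDegree R N j) :
    ExteriorAlgebra.map φ x ∈ exteriorDegree R N' j := by
  cases j with
  | ofNat n =>
    have h : Submodule.map (ExteriorAlgebra.map φ).toLinearMap (⋀[R]^n N) ≤ ⋀[R]^n N' := by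
      rw [ExteriorAlgebra.exteriorPower, Submodule.map_pow, ExteriorAlgebra.ι_range_map_map]
      exact pow_le_pow_left' LinearMap.map_le_range n
    exact h ⟨x, hx, rfl⟩
  | negSucc n =>
    have : x = 0 := hx
    rw [this, map_zero]
    exact Submodule.zero_mem _

/-- The cube `S ↦ ⋀ (N / ρ(S))` of a matroid with a quasi-representation, with the algebra maps
induced by the projections `N / ρ(S) → N / ρ(T)` and graded by exterior degree. -/
def QuasiRepresentation.cube {R : Type*} [CommRing R] [IsDomain R]
    [IsPrincipalIdealRing R] {N : Type*} [AddCommGroup N] [Module R N] [Module.Finite R N]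
    {E : Type*} {M : Matroid E} (Q : QuasiRepresentation R N M) : GradedCube R E where
  obj S := ExteriorAlgebra R (N ⧸ Q.ρ S)
  map h := (ExteriorAlgebra.map
    (Submodule.factor (Q.mono (Finset.coe_subset.2 h)))).toLinearMap
  map_map h h' x := by
    have := ExteriorAlgebra.map_comp_map (Submodule.factor (Q.mono (Finset.coe_subset.2 h)))
      (Submodule.factor (Q.mono (Finset.coe_subset.2 h')))
    rw [Submodule.factor_comp] at this
    exact DFunLike.congr_fun this x
  deg j S := exteriorDegree R (N ⧸ Q.ρ S) j
  map_mem _ j x hx := exteriorDegree_map _ j x hx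

/-- The complex `C^{•,j}(M, ρ)` computing the characteristic cohomology `H^{•,j}(M, ρ)`. -/
def QuasiRepresentation.complex {R : Type*} [CommRing R] [IsDomain R]
    [IsPrincipalIdealRing R] {N : Type*} [AddCommGroup N] [Module R N] [Module.Finite R N]
    {E : Type*} [LinearOrder E] {M : Matroid E} (Q : QuasiRepresentation R N M)
    (j : ℤ) : CochainComplex (ModuleCat R) ℤ :=
  Q.cube.complex j

/-! ### Graphs and graphic matroids -/

namespace Graph

variable {α β : Type*} (G : Graph α β)

/-- The spanning graph `[G:S]`, with vertex set `V(G)` and edge set `S ⊆ E(G)`. Loops and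
multiplicities are forgotten, as only its connected components are used. -/
def spanning (S : Set E(G)) : SimpleGraph V(G) where
  Adj u v := u ≠ v ∧ ∃ e ∈ S, G.IsLink e u v
  symm := ⟨fun _ _ ⟨h, e, he, hl⟩ => ⟨h.symm, e, he, hl.symm⟩⟩
  loopless := ⟨fun _ h => h.1 rfl⟩

/-- A graph is connected if it has a vertex and any two vertices are joined by a path. -/
def IsConn : Prop := (G.spanning Set.univ).Connected

/-- `Conn(S)`, the set of connected components of `[G:S]`. -/
abbrev Conn (S : Set E(G)) : Type _ := (G.spanning S).ConnectedComponent

theorem spanning_mono {S T : Set E(G)} (h : S ⊆ T) : G.spanning S ≤ G.spanning T :=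
  fun _ _ ⟨hne, e, he, hl⟩ => ⟨hne, e, h he, hl⟩

/-- The map `Conn(S) → Conn(T)` for `S ⊆ T`, sending a component to the one which contains it. -/
def connMap {S T : Set E(G)} (h : S ⊆ T) : G.Conn S → G.Conn T :=
  SimpleGraph.ConnectedComponent.map (SimpleGraph.Hom.ofLE (G.spanning_mono h))

theorem connMap_mk {S T : Set E(G)} (h : S ⊆ T) (v : V(G)) :
    G.connMap h ((G.spanning S).connectedComponentMk v) = (G.spanning T).connectedComponentMk v :=
  rfl

theorem connMap_connMap {S T U : Set E(G)} (h : S ⊆ T) (h' : T ⊆ U) (F : G.Conn S) :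
    G.connMap h' (G.connMap h F) = G.connMap (h.trans h') F := by
  induction F using SimpleGraph.ConnectedComponent.ind
  rfl

theorem connMap_surjective {S T : Set E(G)} (h : S ⊆ T) : Function.Surjective (G.connMap h) := by
  intro F
  induction F using SimpleGraph.ConnectedComponent.ind with
  | h v => exact ⟨(G.spanning S).connectedComponentMk v, rfl⟩

/-- `ρ̃(S) = ⟨v - v' | v, v' are the endpoints of some edge in S⟩` in `Ñ = ⨁_{v ∈ V(G)} ℤ v`. -/
def rhoTilde (S : Set E(G)) : Submodule ℤ (V(G) →₀ ℤ) :=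
  Submodule.span ℤ {x | ∃ e ∈ S, ∃ v v' : V(G), G.IsLink e v v' ∧
    x = Finsupp.single v 1 - Finsupp.single v' 1}

theorem rhoTilde_mono {S T : Set E(G)} (h : S ⊆ T) : G.rhoTilde S ≤ G.rhoTilde T :=
  Submodule.span_mono fun _ ⟨e, he, hx⟩ => ⟨e, h he, hx⟩

/-- The map `Ñ → ⨁_{F ∈ Conn(S)} ℤ F` sending a vertex to its component. -/
def toConn (S : Set E(G)) : (V(G) →₀ ℤ) →ₗ[ℤ] (G.Conn S →₀ ℤ) :=
  Finsupp.lmapDomain ℤ ℤ (G.spanning S).connectedComponentMk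

theorem toConn_single (S : Set E(G)) (v : V(G)) (a : ℤ) : G.toConn S (Finsupp.single v a) =
    Finsupp.single ((G.spanning S).connectedComponentMk v) a :=
  Finsupp.mapDomain_single

theorem single_sub_mem_rhoTilde {S : Set E(G)} {u v : V(G)} (h : (G.spanning S).Reachable u v) :
    (Finsupp.single u 1 - Finsupp.single v 1 : V(G) →₀ ℤ) ∈ G.rhoTilde S := by
  obtain ⟨p⟩ := h
  induction p with
  | nil => simp
  | @cons a b c hab _ ih =>
    obtain ⟨_, e, he, hl⟩ := hab
    have h1 : (Finsupp.single a 1 - Finsupp.single b 1 : V(G) →₀ ℤ) ∈ G.rhoTilde S :=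
      Submodule.subset_span ⟨e, he, a, b, hl, rfl⟩
    simpa using add_mem h1 ih

theorem ker_toConn (S : Set E(G)) : LinearMap.ker (G.toConn S) = G.rhoTilde S := by
  apply le_antisymm
  · intro x hx
    let s : (G.Conn S →₀ ℤ) →ₗ[ℤ] (V(G) →₀ ℤ) := Finsupp.lmapDomain ℤ ℤ Quot.out
    have key : ∀ y : V(G) →₀ ℤ, y - s (G.toConn S y) ∈ G.rhoTilde S := by
      intro y
      induction y using Finsupp.induction_linear with
      | zero => simp
      | add f g hf hg =>
        rw [map_add, map_add, add_sub_add_comm]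
        exact add_mem hf hg
      | single v a =>
        have hv : (G.spanning S).Reachable v
            (Quot.out ((G.spanning S).connectedComponentMk v)) :=
          (SimpleGraph.ConnectedComponent.exact (Quot.out_eq _)).symm
        have := Submodule.smul_mem _ a (G.single_sub_mem_rhoTilde hv)
        rw [toConn_single]
        have hs : s (Finsupp.single ((G.spanning S).connectedComponentMk v) a) =
            Finsupp.single (Quot.out ((G.spanning S).connectedComponentMk v)) a :=
          Finsupp.mapDomain_single
        rw [hs]
        simpa [smul_sub] using this
    have := key x
    rwa [LinearMap.mem_ker.1 hx, map_zero, sub_zero] at this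
  · refine Submodule.span_le.2 ?_
    rintro x ⟨e, he, v, v', hl, rfl⟩
    rw [SetLike.mem_coe, LinearMap.mem_ker, map_sub, toConn_single, toConn_single, sub_eq_zero]
    congr 1
    by_cases h : v = v'
    · rw [h]
    · exact SimpleGraph.ConnectedComponent.sound
        (SimpleGraph.Adj.reachable (G := G.spanning S) ⟨h, e, he, hl⟩)

section Rank

variable [Finite V(G)]

instance (S : Set E(G)) : Finite (G.Conn S) := Quot.finite _

/-- The rank function `|V| - k([G:S])` of the graphic matroid; the number `k([G:S])` of connected
components of `[G:S]` never exceeds `|V|`. -/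
def graphicRank (S : Set E(G)) : ℕ := Nat.card V(G) - Nat.card (G.Conn S)

theorem card_conn_le (S : Set E(G)) : Nat.card (G.Conn S) ≤ Nat.card V(G) :=
  Nat.card_le_card_of_surjective (G.spanning S).connectedComponentMk Quot.mk_surjective

theorem finrank_rhoTilde (S : Set E(G)) :
    Module.finrank ℤ (G.rhoTilde S) = G.graphicRank S := by
  have hsurj : Function.Surjective (G.toConn S) :=
    Finsupp.mapDomain_surjective Quot.mk_surjective
  have h1 := Submodule.finrank_quotient_add_finrank (G.rhoTilde S)
  rw [← ker_toConn, ((G.toConn S).quotKerEquivOfSurjective hsurj).finrank_eq, ker_toConn] at h1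
  have := Fintype.ofFinite V(G)
  have := Fintype.ofFinite (G.Conn S)
  rw [Module.finrank_finsupp_self, Module.finrank_finsupp_self] at h1
  rw [graphicRank, Nat.card_eq_fintype_card, Nat.card_eq_fintype_card]
  omega

theorem rhoTilde_eq_of_rank_eq {S T : Set E(G)} (h : S ⊆ T)
    (hr : G.graphicRank S = G.graphicRank T) : G.rhoTilde S = G.rhoTilde T := by
  refine le_antisymm (G.rhoTilde_mono h) (Submodule.span_le.2 ?_)
  rintro x ⟨e, he, v, v', hl, rfl⟩
  refine G.single_sub_mem_rhoTilde (SimpleGraph.ConnectedComponent.exact ?_)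
  have hc : Nat.card (G.Conn S) = Nat.card (G.Conn T) := by
    have h1 := G.card_conn_le S
    have h2 := G.card_conn_le T
    unfold graphicRank at hr
    omega
  have hb : Function.Bijective (G.connMap h) :=
    (Nat.bijective_iff_surjective_and_card _).2 ⟨G.connMap_surjective h, hc⟩
  apply hb.1
  rw [connMap_mk, connMap_mk]
  by_cases hv : v = v'
  · rw [hv]
  · exact SimpleGraph.ConnectedComponent.sound
      (SimpleGraph.Adj.reachable (G := G.spanning T) ⟨hv, e, he, hl⟩)

theorem graphicRank_mono (S T : Set E(G)) (h : S ⊆ T) : G.graphicRank S ≤ G.graphicRank T := by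
  rw [← finrank_rhoTilde, ← finrank_rhoTilde]
  exact Submodule.finrank_mono (G.rhoTilde_mono h)

theorem graphicRank_submod (S T : Set E(G)) :
    G.graphicRank (S ∩ T) + G.graphicRank (S ∪ T) ≤ G.graphicRank S + G.graphicRank T := by
  simp only [← finrank_rhoTilde]
  have h1 : G.rhoTilde (S ∪ T) ≤ G.rhoTilde S ⊔ G.rhoTilde T := by
    refine Submodule.span_le.2 ?_
    rintro x ⟨e, he | he, hx⟩
    · exact (le_sup_left : G.rhoTilde S ≤ _) (Submodule.subset_span ⟨e, he, hx⟩)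
    · exact (le_sup_right : G.rhoTilde T ≤ _) (Submodule.subset_span ⟨e, he, hx⟩)
  have h2 : G.rhoTilde (S ∩ T) ≤ G.rhoTilde S ⊓ G.rhoTilde T :=
    le_inf (G.rhoTilde_mono Set.inter_subset_left) (G.rhoTilde_mono Set.inter_subset_right)
  have h3 := Submodule.finrank_mono h1
  have h4 := Submodule.finrank_mono h2
  have h5 := Submodule.rank_sup_add_rank_inf_eq (G.rhoTilde S) (G.rhoTilde T)
  simp only [← Module.finrank_eq_rank] at h5
  norm_cast at h5
  omega

theorem graphicRank_le_ncard [Finite E(G)] (S : Set E(G)) : G.graphicRank S ≤ S.ncard := by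
  choose a b hab using fun e : E(G) => G.exists_isLink_of_mem_edgeSet e.2
  let f : E(G) → (V(G) →₀ ℤ) := fun e =>
    Finsupp.single ⟨a e, (hab e).left_mem⟩ 1 - Finsupp.single ⟨b e, (hab e).right_mem⟩ 1
  have h : G.rhoTilde S ≤ Submodule.span ℤ (f '' S) := by
    refine Submodule.span_le.2 ?_
    rintro x ⟨e, he, v, v', hl, rfl⟩
    have hf : f e ∈ Submodule.span ℤ (f '' S) := Submodule.subset_span ⟨e, he, rfl⟩
    rcases hl.eq_and_eq_or_eq_and_eq (hab e) with ⟨h1, h2⟩ | ⟨h1, h2⟩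
    · have : (Finsupp.single v 1 - Finsupp.single v' 1 : V(G) →₀ ℤ) = f e := by
        simp only [f]
        congr 2 <;> exact Subtype.ext (by assumption)
      rw [this]
      exact hf
    · have : (Finsupp.single v 1 - Finsupp.single v' 1 : V(G) →₀ ℤ) = -f e := by
        simp only [f, neg_sub]
        congr 2 <;> exact Subtype.ext (by assumption)
      rw [this]
      exact neg_mem hf
  rw [← finrank_rhoTilde]
  refine (Submodule.finrank_mono h).trans ?_
  have := (f '' S).toFinite.fintype
  refine (finrank_span_le_card (R := ℤ) (f '' S)).trans ?_
  rw [Set.toFinset_card, ← Nat.card_eq_fintype_card, Nat.card_coe_set_eq]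
  exact Set.ncard_image_le S.toFinite

/-- The graphic matroid `M(G)`, on the ground set `E(G)`. -/
def graphicMatroid [Finite E(G)] : Matroid E(G) :=
  matroidOfRank G.graphicRank G.graphicRank_le_ncard G.graphicRank_mono G.graphicRank_submod

end Rank

/-! ### The canonical quasi-representation -/

section Canonical

variable [LinearOrder V(G)]

/-- `v` is the minimal vertex `v_{S,F}` of its connected component `F` in `[G:S]`. -/
def IsMinVertex (S : Set E(G)) (v : V(G)) : Prop := ∀ w, (G.spanning S).Reachable v w → v ≤ w

/-- The submodule `I_G = ⟨min V(F) | F ∈ Conn(E(G))⟩` of `Ñ`. -/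
def minSubmodule : Submodule ℤ (V(G) →₀ ℤ) :=
  Submodule.span ℤ ((fun v => Finsupp.single v 1) '' {v | G.IsMinVertex Set.univ v})

theorem disjoint_rhoTilde_minSubmodule (S : Set E(G)) :
    Disjoint (G.rhoTilde S) G.minSubmodule := by
  rw [Submodule.disjoint_def]
  intro x hx hx'
  have h0 : G.toConn Set.univ x = 0 := by
    have := G.rhoTilde_mono (Set.subset_univ S) hx
    rwa [← ker_toConn, LinearMap.mem_ker] at this
  rw [minSubmodule, ← Finsupp.supported_eq_span_single] at hx'
  have hinj : Set.InjOn (G.spanning Set.univ).connectedComponentMk {v | G.IsMinVertex Set.univ v} := by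
    intro v hv w hw h
    have hr := SimpleGraph.ConnectedComponent.exact h
    exact le_antisymm (hv w hr) (hw v hr.symm)
  exact Finsupp.mapDomain_injOn _ hinj hx' (Submodule.zero_mem _ : (0 : V(G) →₀ ℤ) ∈
    Finsupp.supported ℤ ℤ {v | G.IsMinVertex Set.univ v}) (h0.trans (map_zero (G.toConn Set.univ)).symm)

variable [Finite V(G)]

theorem rhoTilde_sup_minSubmodule : G.rhoTilde Set.univ ⊔ G.minSubmodule = ⊤ := by
  rw [eq_top_iff]
  rintro x -
  induction x using Finsupp.induction_linear with
  | zero => exact Submodule.zero_mem _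
  | add f g hf hg => exact add_mem hf hg
  | single v a =>
    obtain ⟨w, hw, hmin⟩ := Set.exists_min_image {w | (G.spanning Set.univ).Reachable v w} id
      (Set.toFinite _) ⟨v, SimpleGraph.Reachable.refl v⟩
    have hw' : G.IsMinVertex Set.univ w := fun u hu => hmin u (SimpleGraph.Reachable.trans hw hu)
    have h1 := Submodule.mem_sup_left (T := G.minSubmodule) (G.single_sub_mem_rhoTilde hw)
    have h2 : (Finsupp.single w 1 : V(G) →₀ ℤ) ∈ G.rhoTilde Set.univ ⊔ G.minSubmodule :=
      Submodule.mem_sup_right (Submodule.subset_span ⟨w, hw', rfl⟩)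
    have := Submodule.smul_mem _ a (add_mem h1 h2)
    simpa using this

/-- The canonical `ℤ`-quasi-representation `ρ(S) = (ρ̃(S) + I_G) / I_G` of `M(G)`, with
`N = ρ(E(G)) = Ñ / I_G`. -/
def canonical [Finite E(G)] :
    QuasiRepresentation ℤ ((V(G) →₀ ℤ) ⧸ G.minSubmodule) G.graphicMatroid where
  ground_eq := rfl
  ρ S := (G.rhoTilde S).map G.minSubmodule.mkQ
  finrank_eq S := by
    have hinj : Function.Injective (G.minSubmodule.mkQ.domRestrict (G.rhoTilde S)) := by
      rw [← LinearMap.ker_eq_bot, eq_bot_iff]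
      rintro ⟨x, hx⟩ h
      have hx' : x ∈ G.minSubmodule := (Submodule.Quotient.mk_eq_zero _).1 h
      exact Subtype.ext (Submodule.disjoint_def.1 (G.disjoint_rhoTilde_minSubmodule S) x hx hx')
    have h := LinearMap.finrank_range_of_inj hinj
    rw [LinearMap.range_domRestrict, finrank_rhoTilde] at h
    rw [h, graphicMatroid, matroidOfRank_rk]
  empty := by
    have : G.rhoTilde ∅ = ⊥ := by simp [rhoTilde]
    rw [this, Submodule.map_bot]
  univ := by
    have h := congrArg (Submodule.map G.minSubmodule.mkQ) G.rhoTilde_sup_minSubmodule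
    rwa [Submodule.map_sup, Submodule.mkQ_map_self, sup_bot_eq, Submodule.map_top,
      Submodule.range_mkQ] at h
  mono h := Submodule.map_mono (G.rhoTilde_mono h)
  eq_of_rank_eq {S T} h hr := by
    rw [graphicMatroid, matroidOfRank_rk, matroidOfRank_rk, Nat.cast_inj] at hr
    rw [G.rhoTilde_eq_of_rank_eq h hr]

/-- The complex `C^{•,j}(M(G))` of the graphic matroid with its canonical quasi-representation. -/
def matroidComplex [Finite E(G)] [LinearOrder E(G)] (j : ℤ) : CochainComplex (ModuleCat ℤ) ℤ :=
  G.canonical.complex j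

end Canonical

/-! ### The chromatic complex -/

open Classical in
/-- For `S ⊆ T`, multiply the labels of the components of `[G:S]` which lie in the same component
of `[G:T]`. A labelling `c : Conn(S) → {1, x}` is encoded by the set `X = c⁻¹(x)`. If two
components labelled `x` lie in the same component of `[G:T]` the result is `0`, because `x * x = 0`;
otherwise the components of `[G:T]` labelled `x` are those which contain one labelled `x`. -/
def mergeLabels {S T : Set E(G)} (h : S ⊆ T) :
    (Finset (G.Conn S) →₀ ℤ) →ₗ[ℤ] (Finset (G.Conn T) →₀ ℤ) :=
  Finsupp.linearCombination ℤ fun X =>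
    if Set.InjOn (G.connMap h) X then Finsupp.single (X.image (G.connMap h)) 1 else 0

theorem mergeLabels_mergeLabels {S T U : Set E(G)} (h : S ⊆ T) (h' : T ⊆ U)
    (x : Finset (G.Conn S) →₀ ℤ) :
    G.mergeLabels h' (G.mergeLabels h x) = G.mergeLabels (h.trans h') x := by
  classical
  have hcomp : G.connMap h' ∘ G.connMap h = G.connMap (h.trans h') :=
    funext (G.connMap_connMap h h')
  induction x using Finsupp.induction_linear with
  | zero => simp
  | add f g hf hg => simp only [map_add, hf, hg]
  | single X a =>
    simp only [mergeLabels, Finsupp.linearCombination_single, map_smul]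
    congr 1
    by_cases h1 : Set.InjOn (G.connMap h) X
    · rw [if_pos h1, Finsupp.linearCombination_single, one_smul]
      have h2 : Set.InjOn (G.connMap h') (G.connMap h '' X) ↔
          Set.InjOn (G.connMap (h.trans h')) X := by
        rw [← hcomp]
        exact ⟨fun h2 => (Set.InjOn.comp_iff h1).2 h2, fun h2 => (Set.InjOn.comp_iff h1).1 h2⟩
      simp only [Finset.coe_image, h2, Finset.image_image, hcomp]
    · rw [if_neg h1, map_zero, if_neg]
      intro h2
      rw [← hcomp] at h2
      exact h1 (Set.InjOn.of_comp h2)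

/-- The module with basis the enhanced states `(S, c)` for every `S`, graded by
`j(S, c) = #c⁻¹(x)`. -/
def chromaticCube : GradedCube ℤ E(G) where
  obj S := Finset (G.Conn (S : Set E(G))) →₀ ℤ
  map h := G.mergeLabels (Finset.coe_subset.2 h)
  map_map h h' x := G.mergeLabels_mergeLabels _ _ x
  deg j _ := Finsupp.supported ℤ ℤ {X | (X.card : ℤ) = j}
  map_mem {S T} h j x hx := by
    classical
    rw [Finsupp.mem_supported] at hx
    rw [mergeLabels, Finsupp.linearCombination_apply]
    refine Submodule.sum_mem _ fun X hX => Submodule.smul_mem _ _ ?_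
    have hXj : (X.card : ℤ) = j := hx hX
    split_ifs with hinj
    · refine Finsupp.single_mem_supported ℤ _ ?_
      rw [Set.mem_ofPred_eq, Finset.card_image_of_injOn hinj, hXj]
    · exact Submodule.zero_mem _

/-- The chromatic complex `C^{•,j}(G)` of Helme-Guizon and Rong. -/
def chromaticComplex [LinearOrder E(G)] (j : ℤ) : CochainComplex (ModuleCat ℤ) ℤ :=
  G.chromaticCube.complex j

/-! ### The map from enhanced states to exterior products -/

section Theta

variable [LinearOrder V(G)] [Finite V(G)] [Finite E(G)]

/-- The product `v_{S,F₁} ∧ ⋯ ∧ v_{S,F_j}` in `⋀ (N / ρ(S))` of the classes of the minimal vertices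
of the components `X = {F₁, …, F_j}` of `[G:S]`, ordered so that `v_{S,F₁} < ⋯ < v_{S,F_j}`. -/
def wedge (S : Set E(G)) (X : Finset (G.Conn S)) :
    ExteriorAlgebra ℤ (((V(G) →₀ ℤ) ⧸ G.minSubmodule) ⧸ G.canonical.ρ S) :=
  ((((Set.toFinite {v | G.IsMinVertex S v ∧
    (G.spanning S).connectedComponentMk v ∈ X}).toFinset.sort (· ≤ ·)).map fun v =>
      ExteriorAlgebra.ι ℤ ((G.canonical.ρ S).mkQ (G.minSubmodule.mkQ (Finsupp.single v 1))))).prod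

/-- The linear map `θ : ⨁ C^{i,j}(G) → ⨁ C^{i,j}(M(G))` with `θ (S, X) = wedge S X`. -/
def theta : (∀ S, G.chromaticCube.obj S) →ₗ[ℤ] (∀ S, G.canonical.cube.obj S) :=
  LinearMap.pi fun S =>
    (Finsupp.linearCombination ℤ (G.wedge S) : (Finset (G.Conn (S : Set E(G))) →₀ ℤ) →ₗ[ℤ]
      ExteriorAlgebra ℤ (((V(G) →₀ ℤ) ⧸ G.minSubmodule) ⧸ G.canonical.ρ S)) ∘ₗ
        LinearMap.proj S

/-- The enhanced state `(S, c)` with `c⁻¹(x) = X`, as an element of `⨁ C^{i,j}(G)`. -/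
def state [DecidableEq E(G)] (S : Finset E(G)) (X : Finset (G.Conn (S : Set E(G)))) :
    ∀ S, G.chromaticCube.obj S :=
  Pi.single S (Finsupp.single X 1 : Finset (G.Conn (S : Set E(G))) →₀ ℤ)

open Classical in
/-- The linear map `τ : ⨁ C^{i,j-1}(M(G)) → ⨁ C^{i,j}(G)` is given by sending the exterior product
of the components in `X` to the enhanced state whose components labelled `x` are those in `X` and
the component of `v₀`, if the latter is not in `X`, and to `0` otherwise. -/
def IsTau (v₀ : V(G)) (τ : (∀ S, G.canonical.cube.obj S) →ₗ[ℤ] (∀ S, G.chromaticCube.obj S)) :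
    Prop :=
  ∀ (S : Finset E(G)) (X : Finset (G.Conn (S : Set E(G)))),
    τ (Pi.single S (G.wedge S X)) =
      if (G.spanning S).connectedComponentMk v₀ ∈ X then 0
      else G.state S (insert ((G.spanning S).connectedComponentMk v₀) X)

end Theta

end Graph

end

/-!
The maps `τ` and `θ` commute with the differentials only up to signs, so they cannot serve as `f`
and `g`: interchanging two labels `x` is multiplication by `-1` in the exterior algebra but has no
effect in the chromatic complex. Instead, the labellings for which the component of `v₀` has the
label `x` span a subcomplex of the chromatic complex in every degree `j`, and multiplication by `x`
at the component of `v₀` identifies the quotient with the subcomplex of the same kind for `j + 1`.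
It remains to see that this rooted complex is isomorphic to the characteristic complex of `M(G)`.
Both are bounded complexes of finitely generated free groups. By deletion and contraction, the
cohomology of each is torsion-free and concentrated in the single degree `r - j`, where `r` is the
rank of `M(G)`, so it splits and is determined up to isomorphism by its ranks; these agree because
`τ` maps one bijectively onto the other.
-/

noncomputable section

theorem piMap_single {ι R : Type*} {M N : ι → Type*} [DecidableEq ι] [Semiring R]
    [∀ i, AddCommMonoid (M i)] [∀ i, AddCommMonoid (N i)] [∀ i, Module R (M i)]
    [∀ i, Module R (N i)] (f : ∀ i, M i →ₗ[R] N i) (i : ι) (x : M i) :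
    LinearMap.piMap f (Pi.single i x) = Pi.single i (f i x) :=
  funext fun k => Pi.apply_single (fun k => f k) (fun k => map_zero (f k)) i x k

/-! ### Complexes with cohomology in a single degree -/

theorem exists_linearEquiv_ker_prod {R M P : Type*} [CommRing R] [AddCommGroup M] [Module R M]
    [AddCommGroup P] [Module R P] [Module.Projective R P] (f : M →ₗ[R] P)
    (hf : Function.Surjective f) :
    ∃ e : M ≃ₗ[R] LinearMap.ker f × P,
      (∀ x, (e x).2 = f x) ∧ ∀ x : LinearMap.ker f, e x = (x, 0) := by
  obtain ⟨s, hs⟩ := f.exists_rightInverse_of_surjective (LinearMap.range_eq_top.2 hf)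
  obtain ⟨e, hinl, hsnd⟩ := (LinearMap.exact_subtype_ker_map f).splitSurjectiveEquiv
    (Submodule.subtype_injective _) ⟨s, hs⟩
  refine ⟨e, fun x => (LinearMap.congr_fun hsnd x).symm, fun x => ?_⟩
  exact (e.symm_apply_eq.1 (LinearMap.congr_fun hinl x).symm).symm

theorem exists_linearEquiv_prod_prod {R B M P : Type*} [CommRing R] [IsDomain R]
    [IsPrincipalIdealRing R] [AddCommGroup B] [Module R B] [AddCommGroup M] [Module R M]
    [AddCommGroup P] [Module R P] [Module.Finite R M] [Module.Free R P] (ι : B →ₗ[R] M)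
    (hι : Function.Injective ι) [Module.Free R (M ⧸ LinearMap.range ι)] (g : M →ₗ[R] P)
    (hg : Function.Surjective g) (hgι : ∀ b, g (ι b) = 0) :
    ∃ (q : ℕ) (e : M ≃ₗ[R] B × (Fin q → R) × P),
      (∀ b, e (ι b) = (b, 0, 0)) ∧ ∀ x, (e x).2.2 = g x := by
  obtain ⟨e₁, hsnd₁, hker₁⟩ := exists_linearEquiv_ker_prod (LinearMap.range ι).mkQ
    (Submodule.mkQ_surjective _)
  let g' : (M ⧸ LinearMap.range ι) →ₗ[R] P := (LinearMap.range ι).liftQ g <| by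
    rintro _ ⟨b, rfl⟩
    exact hgι b
  obtain ⟨e₂, hsnd₂, -⟩ := exists_linearEquiv_ker_prod g' fun p =>
    (hg p).imp' (LinearMap.range ι).mkQ fun _ hx => hx
  let κ : LinearMap.ker (LinearMap.range ι).mkQ ≃ₗ[R] B :=
    (LinearEquiv.ofEq _ _ (LinearMap.range ι).ker_mkQ).trans (LinearEquiv.ofInjective ι hι).symm
  refine ⟨Module.finrank R (LinearMap.ker g'), e₁.trans (κ.prodCongr (e₂.trans
    ((Module.finBasis R (LinearMap.ker g')).equivFun.prodCongr (.refl R P)))),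
    fun b => ?_, fun x => ?_⟩
  · have hb : ι b ∈ LinearMap.ker (LinearMap.range ι).mkQ := by
      rw [Submodule.ker_mkQ]
      exact ⟨b, rfl⟩
    have hκ : κ ⟨ι b, hb⟩ = b :=
      (LinearEquiv.ofInjective ι hι).symm_apply_eq.2 (Subtype.ext rfl)
    rw [LinearEquiv.trans_apply, hker₁ ⟨ι b, hb⟩, LinearEquiv.prodCongr_apply, hκ, map_zero]
    rfl
  · change (e₂ (e₁ x).2).2 = g x
    rw [hsnd₂, hsnd₁]
    rfl

theorem eq_of_add_succ_eq_add_succ {b b' : ℤ → ℕ} {k N : ℤ}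
    (hzero : ∀ i, N < |i| → b i = b' i)
    (hadd : ∀ i ≠ k, b i + b (i + 1) = b' i + b' (i + 1)) : b = b' := by
  have hlow : ∀ i, min (-N - 1) k ≤ i → i ≤ k → b i = b' i := by
    intro i hi
    induction i, hi using Int.leInduction with
    | base =>
      intro _
      by_cases hN : 0 ≤ N
      · exact hzero _ (by rw [lt_abs]; omega)
      · exact hzero _ (by have := abs_nonneg (min (-N - 1) k); omega)
    | succ i _ ih =>
      intro hik
      have := ih (by omega)
      have := hadd i (by omega)
      omega
  have hhigh : ∀ i, i ≤ max (N + 1) (k + 1) → k < i → b i = b' i := by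
    intro i hi
    induction i, hi using Int.leInductionDown with
    | base => exact fun _ => hzero _ (by rw [lt_abs]; omega)
    | pred i _ ih =>
      intro hik
      have := ih (by omega)
      have := hadd (i - 1) (by omega)
      rw [sub_add_cancel] at this
      omega
  funext i
  by_cases hi : N < |i|
  · exact hzero i hi
  · obtain ⟨h₁, h₂⟩ := abs_le.1 (not_lt.1 hi)
    rcases le_or_gt i k with hk | hk
    · exact hlow i (by omega) hk
    · exact hhigh i (by omega) hk

/-- A complex of `R`-modules, presented as an endomorphism `d` of square zero of an ambient
module together with submodules `C i` such that `d` maps `C i` to `C (i + 1)`. -/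
structure IsDifferential {R V : Type*} [CommRing R] [AddCommGroup V] [Module R V]
    (d : V →ₗ[R] V) (C : ℤ → Submodule R V) : Prop where
  d_d : ∀ x, d (d x) = 0
  mem : ∀ i, ∀ x ∈ C i, d x ∈ C (i + 1)

/-- The cohomology of the complex `(C, d)` vanishes outside degree `k`, and in degree `k` it is
torsion-free. -/
structure IsConcentrated {R V : Type*} [CommRing R] [AddCommGroup V] [Module R V]
    (d : V →ₗ[R] V) (C : ℤ → Submodule R V) (k : ℤ) : Prop where
  exact : ∀ i ≠ k, ∀ x ∈ C i, d x = 0 → ∃ y ∈ C (i - 1), d y = x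
  saturated : ∀ n : R, n ≠ 0 → ∀ x ∈ C k, ∀ y ∈ C (k - 1), d y = n • x → ∃ z ∈ C (k - 1), d z = x

section Concentrated

variable {R V W : Type*} [CommRing R] [AddCommGroup V] [Module R V] [AddCommGroup W] [Module R W]
  {d : V →ₗ[R] V} {d' : W →ₗ[R] W} {C : ℤ → Submodule R V} {C' : ℤ → Submodule R W} {k : ℤ}

theorem IsDifferential.mem_of_mem_pred (hC : IsDifferential d C) {i : ℤ} {x : V}
    (hx : x ∈ C (i - 1)) : d x ∈ C i := by
  simpa using hC.mem _ x hx

theorem IsConcentrated.of_eq_bot (h : ∀ i, C i = ⊥) : IsConcentrated d C k where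
  exact i _ x hx _ := ⟨0, zero_mem _, by simp_all⟩
  saturated n _ x hx _ _ _ := ⟨0, zero_mem _, by simp_all⟩

theorem IsConcentrated.of_ker_of_map (hC : IsDifferential d C) (p : V →ₗ[R] W)
    (hp : ∀ x, d' (p x) = p (d x))
    (hker : IsConcentrated d (fun i => C i ⊓ LinearMap.ker p) k)
    (hmap : IsConcentrated d' (fun i => (C i).map p) k) : IsConcentrated d C k where
  exact i hi x hx hdx := by
    obtain ⟨_, ⟨y, hy, rfl⟩, hyx⟩ := hmap.exact i hi (p x) ⟨x, hx, rfl⟩ (by rw [hp, hdx, map_zero])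
    obtain ⟨z, hz, hzx⟩ := hker.exact i hi (x - d y)
      ⟨sub_mem hx (hC.mem_of_mem_pred hy),
        LinearMap.mem_ker.2 <| by rw [map_sub, ← hp, hyx, sub_self]⟩
      (by rw [map_sub, hdx, hC.d_d, sub_zero])
    exact ⟨y + z, add_mem hy hz.1, by rw [map_add, hzx, add_sub_cancel]⟩
  saturated n hn x hx y hy hyx := by
    obtain ⟨_, ⟨z, hz, rfl⟩, hzx⟩ := hmap.saturated n hn (p x) ⟨x, hx, rfl⟩ (p y) ⟨y, hy, rfl⟩
      (by rw [hp, hyx, map_smul])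
    have hcycle : d' (p (y - n • z)) = 0 := by
      rw [map_sub, map_sub, hp, hyx, map_smul, map_smul, map_smul, hzx, sub_self]
    obtain ⟨_, ⟨w, hw, rfl⟩, hwy⟩ := hmap.exact (k - 1) (by omega) (p (y - n • z))
      ⟨_, sub_mem hy (Submodule.smul_mem _ n hz), rfl⟩ hcycle
    obtain ⟨u, hu, hux⟩ := hker.saturated n hn (x - d z)
      ⟨sub_mem hx (hC.mem_of_mem_pred hz),
        LinearMap.mem_ker.2 <| by rw [map_sub, ← hp, hzx, sub_self]⟩
      (y - n • z - d w)
      ⟨sub_mem (sub_mem hy (Submodule.smul_mem _ n hz)) (hC.mem_of_mem_pred hw),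
        LinearMap.mem_ker.2 <| by rw [map_sub, ← hp, hwy, sub_self]⟩
      (by rw [map_sub, map_sub, hC.d_d, sub_zero, hyx, map_smul, smul_sub])
    exact ⟨z + u, add_mem hz hu.1, by rw [map_add, hux, add_sub_cancel]⟩

/-- The hypothesis `hlift` makes the quotient of `C` by the largest subcomplex of `ker q`
acyclic. -/
theorem IsConcentrated.of_subcomplex_ker [IsDomain R] [Module.IsTorsionFree R V]
    (hC : IsDifferential d C) (q : V →ₗ[R] W)
    (hlift : ∀ i, ∀ x ∈ C i, ∃ a ∈ C (i - 1), q (d a) = q x)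
    (hker : IsConcentrated d (fun i => C i ⊓ (LinearMap.ker q ⊓ LinearMap.ker (q ∘ₗ d))) k) :
    IsConcentrated d C k where
  exact i hi x hx hdx := by
    obtain ⟨a, ha, hax⟩ := hlift i x hx
    obtain ⟨y, hy, hyx⟩ := hker.exact i hi (x - d a)
      ⟨sub_mem hx (hC.mem_of_mem_pred ha), by simp [hax], by simp [hdx, hC.d_d]⟩
      (by rw [map_sub, hdx, hC.d_d, sub_zero])
    exact ⟨a + y, add_mem ha hy.1, by rw [map_add, hyx, add_sub_cancel]⟩
  saturated n hn x hx y hy hyx := by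
    have hdx : d x = 0 := (smul_eq_zero.1 (by rw [← map_smul, ← hyx, hC.d_d])).resolve_left hn
    obtain ⟨a, ha, hax⟩ := hlift k x hx
    obtain ⟨c, hc, hcy⟩ := hlift (k - 1) (y - n • a) (sub_mem hy (Submodule.smul_mem _ n ha))
    have hd : d (y - n • a - d c) = n • (x - d a) := by
      rw [map_sub, map_sub, hC.d_d, sub_zero, hyx, map_smul, smul_sub]
    obtain ⟨z, hz, hzx⟩ := hker.saturated n hn (x - d a)
      ⟨sub_mem hx (hC.mem_of_mem_pred ha), by simp [hax], by simp [hdx, hC.d_d]⟩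
      (y - n • a - d c)
      ⟨sub_mem (sub_mem hy (Submodule.smul_mem _ n ha)) (hC.mem_of_mem_pred hc),
        by simp [hcy], LinearMap.mem_ker.2 (by rw [LinearMap.comp_apply, hd]; simp [hax])⟩ hd
    exact ⟨a + z, add_mem ha hz.1, by rw [map_add, hzx, add_sub_cancel]⟩

theorem IsConcentrated.of_span {U : Type*} [AddCommGroup U] [Module R U] {dU : U →ₗ[R] U}
    {CU : ℤ → Submodule R U} (hU : IsDifferential dU CU) (μ : U →ₗ[R] V) (ν : U →ₗ[R] W)
    (hμC : ∀ i, (CU i).map μ = C i) (hνC : ∀ i, (CU i).map ν = C' (i + 1))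
    (hμν : ∀ i, ∀ x ∈ CU i, μ x = 0 ↔ ν x = 0)
    (hμd : ∀ i, ∀ x ∈ CU i, d (μ x) = μ (dU x)) (hνd : ∀ i, ∀ x ∈ CU i, d' (ν x) = -ν (dU x))
    (h : IsConcentrated d' C' (k + 1)) : IsConcentrated d C k := by
  have hlift : ∀ i, ∀ x ∈ CU i, (∃ b ∈ C' i, d' b = ν x) → ∃ y ∈ C (i - 1), d y = μ x := by
    rintro i x hx ⟨b, hb, hbx⟩
    obtain ⟨y, hy, rfl⟩ := (hνC (i - 1)).ge (by rwa [sub_add_cancel])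
    refine ⟨μ (-y), (hμC _).le ⟨-y, neg_mem hy, rfl⟩, ?_⟩
    have h0 : ν (x + dU y) = 0 := by rw [map_add, ← hbx, hνd _ y hy, neg_add_cancel]
    have := (hμν i _ (add_mem hx (hU.mem_of_mem_pred hy))).2 h0
    rw [hμd _ _ (neg_mem hy), map_neg, map_neg, eq_comm]
    rwa [map_add, add_eq_zero_iff_eq_neg] at this
  constructor
  · intro i hi x hx hdx
    obtain ⟨u, hu, rfl⟩ := (hμC i).ge hx
    rw [hμd i u hu, hμν _ _ (hU.mem i u hu)] at hdx
    have := h.exact (i + 1) (by omega) (ν u) ((hνC i).le ⟨u, hu, rfl⟩)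
      (by rw [hνd i u hu, hdx, neg_zero])
    rw [add_sub_cancel_right] at this
    exact hlift i u hu this
  · intro n hn x hx y hy hyx
    obtain ⟨u, hu, rfl⟩ := (hμC k).ge hx
    obtain ⟨w, hw, rfl⟩ := (hμC (k - 1)).ge hy
    have hν : ν (dU w - n • u) = 0 := by
      rw [← hμν k _ (sub_mem (hU.mem_of_mem_pred hw) (Submodule.smul_mem _ n hu)), map_sub,
        ← hμd _ w hw, hyx, map_smul, sub_self]
    have hνy : d' (-ν w) = n • ν u := by
      rw [map_neg, hνd _ w hw, neg_neg, ← map_smul, ← sub_eq_zero, ← map_sub, hν]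
    have hmem : -ν w ∈ C' (k + 1 - 1) := by
      rw [add_sub_cancel_right, ← sub_add_cancel k 1]
      exact neg_mem ((hνC (k - 1)).le ⟨w, hw, rfl⟩)
    have := h.saturated n hn (ν u) ((hνC k).le ⟨u, hu, rfl⟩) _ hmem hνy
    rw [add_sub_cancel_right] at this
    exact hlift k u hu this

/-- The coboundaries of degree `i` of the complex `(C, d)`. -/
def coboundaries (d : V →ₗ[R] V) (C : ℤ → Submodule R V) (i : ℤ) : Submodule R V :=
  (C (i - 1)).map d

theorem IsDifferential.coboundaries_le (hC : IsDifferential d C) (i : ℤ) :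
    coboundaries d C i ≤ C i := by
  rintro _ ⟨y, hy, rfl⟩
  exact hC.mem_of_mem_pred hy

theorem map_mem_coboundaries {i : ℤ} {x : V} (hx : x ∈ C i) : d x ∈ coboundaries d C (i + 1) :=
  ⟨x, by rwa [add_sub_cancel_right], rfl⟩

/-- The differential `C i → C (i + 1)`, corestricted to the coboundaries. -/
def toCoboundaries (d : V →ₗ[R] V) (C : ℤ → Submodule R V) (i : ℤ) :
    C i →ₗ[R] coboundaries d C (i + 1) :=
  d.restrict fun _ => map_mem_coboundaries

theorem toCoboundaries_surjective (i : ℤ) : Function.Surjective (toCoboundaries d C i) := by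
  rintro ⟨_, y, hy, rfl⟩
  rw [add_sub_cancel_right] at hy
  exact ⟨⟨y, hy⟩, rfl⟩

variable [IsDomain R]

theorem IsConcentrated.mem_coboundaries_of_smul [Module.IsTorsionFree R V]
    (h : IsConcentrated d C k) (hC : IsDifferential d C) {i : ℤ} {n : R} (hn : n ≠ 0) {x : V}
    (hx : x ∈ C i) (hnx : n • x ∈ coboundaries d C i) : x ∈ coboundaries d C i := by
  obtain ⟨y, hy, hyx⟩ := hnx
  by_cases hi : i = k
  · subst hi
    exact h.saturated n hn x hx y hy hyx
  · refine h.exact i hi x hx ((smul_eq_zero.1 ?_).resolve_left hn)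
    rw [← map_smul, ← hyx, hC.d_d]

theorem IsConcentrated.isTorsionFree_quotient [Module.IsTorsionFree R V]
    (h : IsConcentrated d C k) (hC : IsDifferential d C) (i : ℤ) :
    Module.IsTorsionFree R
      (C i ⧸ LinearMap.range (Submodule.inclusion (hC.coboundaries_le i))) := by
  refine .of_smul_eq_zero fun n x hx => or_iff_not_imp_left.2 fun hn => ?_
  obtain ⟨x, rfl⟩ := Submodule.mkQ_surjective _ x
  rw [← map_smul, Submodule.mkQ_apply, Submodule.Quotient.mk_eq_zero,
    Submodule.range_inclusion] at hx
  rw [Submodule.mkQ_apply, Submodule.Quotient.mk_eq_zero, Submodule.range_inclusion]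
  exact h.mem_coboundaries_of_smul hC hn x.2 hx

variable [IsPrincipalIdealRing R] [Module.Finite R V]

theorem IsConcentrated.finrank_eq (h : IsConcentrated d C k) (hC : IsDifferential d C) {i : ℤ}
    (hi : i ≠ k) : Module.finrank R (coboundaries d C i) +
      Module.finrank R (coboundaries d C (i + 1)) = Module.finrank R (C i) := by
  have hker : LinearMap.ker (toCoboundaries d C i) =
      LinearMap.range (Submodule.inclusion (hC.coboundaries_le i)) := by
    ext x
    rw [Submodule.range_inclusion, Submodule.mem_comap, LinearMap.mem_ker, ← Submodule.coe_eq_zero]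
    refine ⟨h.exact i hi x x.2, ?_⟩
    rintro ⟨y, -, hyx⟩
    exact (congrArg d hyx).symm.trans (hC.d_d y)
  have hι := LinearEquiv.ofInjective _ (Submodule.inclusion_injective (hC.coboundaries_le i))
  rw [← (LinearMap.ker (toCoboundaries d C i)).finrank_quotient_add_finrank,
    ((toCoboundaries d C i).quotKerEquivOfSurjective (toCoboundaries_surjective i)).finrank_eq,
    hker, ← hι.finrank_eq, add_comm]

variable [Module.Finite R W]

theorem IsConcentrated.finrank_coboundaries_eq (h : IsConcentrated d C k)
    (hC : IsDifferential d C) (h' : IsConcentrated d' C' k) (hC' : IsDifferential d' C')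
    (hrank : ∀ i, Module.finrank R (C i) = Module.finrank R (C' i)) {N : ℤ}
    (hzero : ∀ i, N < |i| → C i = ⊥) (i : ℤ) :
    Module.finrank R (coboundaries d C i) = Module.finrank R (coboundaries d' C' i) := by
  refine congrFun (eq_of_add_succ_eq_add_succ (k := k) (N := N)
    (b := fun i => Module.finrank R (coboundaries d C i))
    (b' := fun i => Module.finrank R (coboundaries d' C' i)) (fun i hi => ?_) fun i hi => ?_) i
  · have hrank₀ : Module.finrank R (C i) = 0 := by rw [hzero i hi, finrank_bot]
    have := Submodule.finrank_mono (hC.coboundaries_le i)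
    have := Submodule.finrank_mono (hC'.coboundaries_le i)
    have := hrank i
    omega
  · rw [h.finrank_eq hC hi, h'.finrank_eq hC' hi, hrank]

variable [Module.IsTorsionFree R V] [Module.IsTorsionFree R W]

theorem IsConcentrated.exists_linearEquiv_prod (h : IsConcentrated d C k)
    (hC : IsDifferential d C) (i : ℤ) :
    ∃ (q : ℕ) (e : C i ≃ₗ[R] coboundaries d C i × (Fin q → R) × coboundaries d C (i + 1)),
      (∀ b, e (Submodule.inclusion (hC.coboundaries_le i) b) = (b, 0, 0)) ∧
      ∀ x, ((e x).2.2 : V) = d x := by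
  let ι := Submodule.inclusion (hC.coboundaries_le i)
  have : Module.IsTorsionFree R (C i ⧸ LinearMap.range ι) := h.isTorsionFree_quotient hC i
  have hdι : ∀ b, toCoboundaries d C i (ι b) = 0 := by
    rintro ⟨_, y, -, rfl⟩
    exact Subtype.ext (hC.d_d y)
  obtain ⟨q, e, hι, hsnd⟩ := exists_linearEquiv_prod_prod ι (Submodule.inclusion_injective _)
    (toCoboundaries d C i) (toCoboundaries_surjective i) hdι
  exact ⟨q, e, hι, fun x => congrArg Subtype.val (hsnd x)⟩

/-- Both complexes split into their coboundaries, a complement of those in the cocycles, and a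
copy of the coboundaries in the next degree. -/
theorem IsConcentrated.exists_linearEquiv (h : IsConcentrated d C k)
    (hC : IsDifferential d C) (h' : IsConcentrated d' C' k) (hC' : IsDifferential d' C')
    (hrank : ∀ i, Module.finrank R (C i) = Module.finrank R (C' i)) {N : ℤ}
    (hzero : ∀ i, N < |i| → C i = ⊥) :
    ∃ φ : ∀ i, C i ≃ₗ[R] C' i,
      ∀ i (x : C i), (φ (i + 1) ⟨d x, hC.mem i x x.2⟩ : W) = d' (φ i x) := by
  have hb := h.finrank_coboundaries_eq hC h' hC' hrank hzero
  let ψ i := LinearEquiv.ofFinrankEq _ _ (hb i)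
  choose q e hι hsnd using h.exists_linearEquiv_prod hC
  choose q' e' hι' hsnd' using h'.exists_linearEquiv_prod hC'
  have hq i : q i = q' i := by
    have h₁ := (e i).finrank_eq
    have h₂ := (e' i).finrank_eq
    simp only [Module.finrank_prod, Module.finrank_fin_fun] at h₁ h₂
    have := hrank i
    have := hb i
    have := hb (i + 1)
    omega
  obtain rfl : q = q' := funext hq
  let φ i : C i ≃ₗ[R] C' i := (e i).trans
    (((ψ i).prodCongr ((LinearEquiv.refl R (Fin (q i) → R)).prodCongr (ψ (i + 1)))).trans
      (e' i).symm)
  have hφ i b : φ i (Submodule.inclusion (hC.coboundaries_le i) b) =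
      Submodule.inclusion (hC'.coboundaries_le i) (ψ i b) := by
    refine (e' i).injective ?_
    simp [φ, hι, hι']
  refine ⟨φ, fun i x => ?_⟩
  have hd : (⟨d x, hC.mem i x x.2⟩ : C (i + 1)) =
      Submodule.inclusion (hC.coboundaries_le (i + 1)) (e i x).2.2 := Subtype.ext (hsnd i x).symm
  rw [hd, hφ, ← hsnd']
  simp [φ]

end Concentrated

section ShortExact

variable {R : Type*} [Ring R]

theorem exists_shortExact_of_iso {ι : Type*} {c : ComplexShape ι}
    {K : ShortComplex (HomologicalComplex (ModuleCat R) c)}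
    (hK : K.ShortExact) {X Z : HomologicalComplex (ModuleCat R) c} (φ : X ≅ K.X₁) (ψ : K.X₃ ≅ Z) :
    ∃ (f : X ⟶ K.X₂) (g : K.X₂ ⟶ Z) (w : f ≫ g = 0), (ShortComplex.mk f g w).ShortExact ∧
      (∀ i, LinearMap.range (f.f i).hom = LinearMap.range (K.f.f i).hom) ∧
      ∀ i, LinearMap.ker (g.f i).hom = LinearMap.ker (K.g.f i).hom := by
  have w : (φ.hom ≫ K.f) ≫ K.g ≫ ψ.hom = 0 := by
    rw [Category.assoc, K.zero_assoc, Limits.zero_comp, Limits.comp_zero]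
  refine ⟨_, _, w, ShortComplex.shortExact_of_iso (ShortComplex.isoMk φ.symm (Iso.refl _) ψ
    (by simp) (by simp)) hK, fun i => ?_, fun i => ?_⟩
  · rw [HomologicalComplex.comp_f, ModuleCat.hom_comp, LinearMap.range_comp_of_range_eq_top]
    exact LinearMap.range_eq_top.2 ((ModuleCat.epi_iff_surjective (φ.hom.f i)).1 inferInstance)
  · rw [HomologicalComplex.comp_f, ModuleCat.hom_comp, LinearMap.ker_comp_of_ker_eq_bot]
    exact LinearMap.ker_eq_bot.2 ((ModuleCat.mono_iff_injective (ψ.hom.f i)).1 inferInstance)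

theorem exact_homologyMap_δ {ι : Type*} {c : ComplexShape ι}
    {K : ShortComplex (HomologicalComplex (ModuleCat R) c)} (hK : K.ShortExact)
    (i i' : ι) (h : c.Rel i i') :
    Function.Exact (HomologicalComplex.homologyMap K.f i).hom
        (HomologicalComplex.homologyMap K.g i).hom ∧
      Function.Exact (HomologicalComplex.homologyMap K.g i).hom (hK.δ i i' h).hom ∧
      Function.Exact (hK.δ i i' h).hom (HomologicalComplex.homologyMap K.f i').hom :=
  ⟨(ShortComplex.ShortExact.moduleCat_exact_iff_function_exact _).1 (hK.homology_exact₂ i),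
    (ShortComplex.ShortExact.moduleCat_exact_iff_function_exact _).1 (hK.homology_exact₃ i i' h),
    (ShortComplex.ShortExact.moduleCat_exact_iff_function_exact _).1 (hK.homology_exact₁ i i' h)⟩

end ShortExact

/-! ### Deletion and contraction in cubes of graded modules -/

namespace GradedCube

section Subcube

variable {R : Type*} [CommRing R] {E : Type*} {K : GradedCube R E}

/-- Keeps the components at the sets satisfying `p` and kills all others. -/
def restrict (K : GradedCube R E) (p : Finset E → Prop) [DecidablePred p] :
    (∀ S, K.obj S) →ₗ[R] ∀ S, K.obj S :=
  LinearMap.pi fun S => if p S then LinearMap.proj S else 0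

theorem restrict_of_pos (p : Finset E → Prop) [DecidablePred p] {S : Finset E} (hS : p S)
    (x : ∀ S, K.obj S) : K.restrict p x S = x S := by
  simp [restrict, hS]

theorem restrict_of_neg (p : Finset E → Prop) [DecidablePred p] {S : Finset E} (hS : ¬p S)
    (x : ∀ S, K.obj S) : K.restrict p x S = 0 := by
  simp [restrict, hS]

/-- The chains of bidegree `(i, j)` supported on the sets `S` with `A ⊆ S ⊆ B`. They compute the
cohomology of the minor obtained by contracting `A` and deleting the complement of `B`. -/
def chainOn (K : GradedCube R E) (A B : Finset E) (i j : ℤ) : Submodule R (∀ S, K.obj S) where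
  carrier := {x | x ∈ K.chain i j ∧ ∀ S, x S ≠ 0 → A ⊆ S ∧ S ⊆ B}
  zero_mem' := ⟨zero_mem _, fun _ h => absurd rfl h⟩
  add_mem' {x y} hx hy := ⟨add_mem hx.1 hy.1, fun S hS => by
    by_cases hxS : x S = 0
    · exact hy.2 S fun hyS => hS (by rw [Pi.add_apply, hxS, hyS, add_zero])
    · exact hx.2 S hxS⟩
  smul_mem' c x hx := ⟨Submodule.smul_mem _ c hx.1, fun S hS =>
    hx.2 S fun hxS => hS (by rw [Pi.smul_apply, hxS, smul_zero])⟩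

theorem mem_chainOn {A B : Finset E} {i j : ℤ} {x : ∀ S, K.obj S} : x ∈ K.chainOn A B i j ↔
    ∀ S, x S ∈ K.deg j S ∧ (x S ≠ 0 → (S.card : ℤ) = i ∧ A ⊆ S ∧ S ⊆ B) :=
  ⟨fun hx S => ⟨(hx.1 S).1, fun hS => ⟨not_imp_comm.1 (hx.1 S).2 hS, hx.2 S hS⟩⟩,
    fun hx => ⟨fun S => ⟨(hx S).1, not_imp_comm.1 fun hS => ((hx S).2 hS).1⟩,
      fun S hS => ((hx S).2 hS).2⟩⟩

theorem eq_zero_of_mem_chainOn {A B S : Finset E} {i j : ℤ} {x : ∀ S, K.obj S}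
    (hx : x ∈ K.chainOn A B i j) (hS : ¬(A ⊆ S ∧ S ⊆ B)) : x S = 0 :=
  not_imp_comm.1 (hx.2 S) hS

theorem chainOn_empty_univ [Fintype E] (K : GradedCube R E) (i j : ℤ) :
    K.chainOn ∅ Finset.univ i j = K.chain i j := by
  ext x
  exact ⟨fun hx => hx.1, fun hx => ⟨hx, fun S _ => ⟨S.empty_subset, S.subset_univ⟩⟩⟩

theorem exists_mem_chainOn {A B : Finset E} {i j : ℤ} {P : ∀ S, K.obj S → Prop}
    (hP : ∀ S, (S.card : ℤ) = i → A ⊆ S → S ⊆ B → ∃ u ∈ K.deg j S, P S u) :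
    ∃ x ∈ K.chainOn A B i j, ∀ S, (S.card : ℤ) = i → A ⊆ S → S ⊆ B → P S (x S) := by
  classical
  choose u hu huP using hP
  refine ⟨fun S => if h : (S.card : ℤ) = i ∧ A ⊆ S ∧ S ⊆ B then u S h.1 h.2.1 h.2.2 else 0,
    mem_chainOn.2 fun S => ?_, fun S hi hA hB => ?_⟩
  · by_cases h : (S.card : ℤ) = i ∧ A ⊆ S ∧ S ⊆ B
    · simpa [h] using hu S h.1 h.2.1 h.2.2
    · simp [h]
  · simpa [hi, hA, hB] using huP S hi hA hB

theorem chain_eq_bot [Fintype E] (K : GradedCube R E) {i : ℤ} (hi : Fintype.card E < |i|) (j : ℤ) :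
    K.chain i j = ⊥ := by
  refine (Submodule.eq_bot_iff _).2 fun x hx => funext fun S => (hx S).2 fun hS => ?_
  rw [← hS, Nat.abs_cast] at hi
  exact absurd S.card_le_univ (by omega)

variable [LinearOrder E]

/-- The differential of the subcube of the sets `S ⊆ B`. -/
def diffOn (K : GradedCube R E) (B : Finset E) : (∀ S, K.obj S) →ₗ[R] ∀ S, K.obj S :=
  K.restrict (· ⊆ B) ∘ₗ K.diff

theorem diffOn_of_subset {B S : Finset E} (hS : S ⊆ B) (x : ∀ S, K.obj S) :
    K.diffOn B x S = K.diff x S :=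
  restrict_of_pos (· ⊆ B) hS _

theorem diffOn_of_not_subset {B S : Finset E} (hS : ¬S ⊆ B) (x : ∀ S, K.obj S) :
    K.diffOn B x S = 0 :=
  restrict_of_neg (· ⊆ B) hS _

theorem diffOn_univ [Fintype E] (K : GradedCube R E) : K.diffOn Finset.univ = K.diff :=
  LinearMap.ext fun x => funext fun S => diffOn_of_subset S.subset_univ x

theorem diff_congr {S : Finset E} {x y : ∀ S, K.obj S}
    (h : ∀ e ∈ S, x (S.erase e) = y (S.erase e)) : K.diff x S = K.diff y S := by
  rw [diff_apply, diff_apply]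
  exact Finset.sum_congr rfl fun e he => by rw [h e he]

theorem diffOn_diffOn (B : Finset E) (x : ∀ S, K.obj S) : K.diffOn B (K.diffOn B x) = 0 := by
  funext S
  by_cases hS : S ⊆ B
  · rw [diffOn_of_subset hS, Pi.zero_apply, ← Pi.zero_apply (M := K.obj) S, ← K.diff_diff x]
    exact diff_congr fun e _ => diffOn_of_subset ((S.erase_subset e).trans hS) x
  · rw [diffOn_of_not_subset hS, Pi.zero_apply]

theorem isDifferential_diffOn (K : GradedCube R E) (A B : Finset E) (j : ℤ) :
    IsDifferential (K.diffOn B) fun i => K.chainOn A B i j where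
  d_d := diffOn_diffOn B
  mem i x hx := by
    have hdiff := K.diff_mem rfl j x hx.1
    refine ⟨fun S => ?_, fun S => not_imp_comm.1 fun hS => ?_⟩
    · by_cases hS : S ⊆ B
      · rw [diffOn_of_subset hS]
        exact hdiff S
      · rw [diffOn_of_not_subset hS]
        exact ⟨zero_mem _, fun _ => rfl⟩
    · by_cases hSB : S ⊆ B
      · rw [diffOn_of_subset hSB, diff_apply]
        refine Finset.sum_eq_zero fun e _ => ?_
        rw [eq_zero_of_mem_chainOn hx fun h => hS ⟨h.1.trans (S.erase_subset e), hSB⟩, map_zero,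
          smul_zero]
      · exact diffOn_of_not_subset hSB x

/-- The cohomology of the subcube of the sets `S` with `A ⊆ S ⊆ B` in internal degree `j` is
concentrated in degree `k`. -/
def IsConcentratedOn (K : GradedCube R E) (A B : Finset E) (j k : ℤ) : Prop :=
  IsConcentrated (K.diffOn B) (fun i => K.chainOn A B i j) k

section DeletionContraction

variable {A B : Finset E} {e : E} {j k : ℤ}

theorem diffOn_restrict_notMem (he : e ∉ B) (x : ∀ S, K.obj S) :
    K.diffOn B (K.restrict (e ∉ ·) x) = K.restrict (e ∉ ·) (K.diffOn (insert e B) x) := by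
  funext S
  by_cases heS : e ∈ S
  · rw [restrict_of_neg (e ∉ ·) (not_not.2 heS), diffOn_of_not_subset fun h => he (h heS)]
  rw [restrict_of_pos (e ∉ ·) heS]
  by_cases hS : S ⊆ B
  · rw [diffOn_of_subset hS, diffOn_of_subset (hS.trans (B.subset_insert e))]
    exact diff_congr fun f _ => restrict_of_pos (e ∉ ·) (fun h => heS (S.erase_subset f h)) x
  · rw [diffOn_of_not_subset hS,
      diffOn_of_not_subset ((Finset.subset_insert_iff_of_notMem heS).not.2 hS)]

theorem chainOn_inf_ker_restrict_mem (he : e ∉ B) (i j : ℤ) :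
    K.chainOn A (insert e B) i j ⊓ LinearMap.ker (K.restrict (e ∈ ·)) = K.chainOn A B i j := by
  ext x
  refine ⟨fun ⟨hx, hker⟩ => ⟨hx.1, fun S hS => ⟨(hx.2 S hS).1, ?_⟩⟩, fun hx =>
    ⟨⟨hx.1, fun S hS => ⟨(hx.2 S hS).1, (hx.2 S hS).2.trans (B.subset_insert e)⟩⟩,
      funext fun S => ?_⟩⟩
  · refine (Finset.subset_insert_iff_of_notMem fun heS => hS ?_).1 (hx.2 S hS).2
    rw [← restrict_of_pos (e ∈ ·) heS x]
    exact congrFun hker S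
  · by_cases heS : e ∈ S
    · rw [restrict_of_pos (e ∈ ·) heS]
      exact eq_zero_of_mem_chainOn hx fun h => he (h.2 heS)
    · exact restrict_of_neg (e ∈ ·) heS x

theorem chainOn_inf_ker_restrict_notMem (i j : ℤ) :
    K.chainOn A (insert e B) i j ⊓ LinearMap.ker (K.restrict (e ∉ ·)) =
      K.chainOn (insert e A) (insert e B) i j := by
  ext x
  refine ⟨fun ⟨hx, hker⟩ => ⟨hx.1, fun S hS =>
    ⟨Finset.insert_subset ?_ (hx.2 S hS).1, (hx.2 S hS).2⟩⟩, fun hx => ⟨⟨hx.1, fun S hS =>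
      ⟨(A.subset_insert e).trans (hx.2 S hS).1, (hx.2 S hS).2⟩⟩, funext fun S => ?_⟩⟩
  · by_contra heS
    refine hS ?_
    rw [← restrict_of_pos (e ∉ ·) heS x]
    exact congrFun hker S
  · by_cases heS : e ∈ S
    · exact restrict_of_neg (e ∉ ·) (not_not.2 heS) x
    · rw [restrict_of_pos (e ∉ ·) heS]
      exact eq_zero_of_mem_chainOn hx fun h => heS (h.1 (A.mem_insert_self e))

theorem map_restrict_notMem_chainOn (he : e ∉ B) (i j : ℤ) :
    (K.chainOn A (insert e B) i j).map (K.restrict (e ∉ ·)) = K.chainOn A B i j := by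
  ext x
  constructor
  · rintro ⟨x, hx, rfl⟩
    refine mem_chainOn.2 fun S => ?_
    by_cases heS : e ∈ S
    · simp [restrict_of_neg (e ∉ ·) (not_not.2 heS)]
    · rw [restrict_of_pos (e ∉ ·) heS, ← Finset.subset_insert_iff_of_notMem heS]
      exact mem_chainOn.1 hx S
  · rw [← chainOn_inf_ker_restrict_mem he]
    refine fun hx => ⟨x, hx.1, funext fun S => ?_⟩
    by_cases heS : e ∈ S
    · rw [restrict_of_neg (e ∉ ·) (not_not.2 heS), ← restrict_of_pos (e ∈ ·) heS x]
      exact (congrFun hx.2 S).symm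
    · exact restrict_of_pos (e ∉ ·) heS x

theorem IsConcentratedOn.of_contract_of_delete (he : e ∉ B)
    (hcontract : K.IsConcentratedOn (insert e A) (insert e B) j k)
    (hdelete : K.IsConcentratedOn A B j k) : K.IsConcentratedOn A (insert e B) j k :=
  .of_ker_of_map (K.isDifferential_diffOn A _ j) (K.restrict (e ∉ ·)) (diffOn_restrict_notMem he)
    (by simpa only [IsConcentratedOn, chainOn_inf_ker_restrict_notMem] using hcontract)
    (by simpa only [IsConcentratedOn, map_restrict_notMem_chainOn he] using hdelete)

/-- The part of the differential of the subcube below `insert e B` with values in the sets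
containing `e`. -/
def diffInsert (K : GradedCube R E) (B : Finset E) (e : E) :
    (∀ S, K.obj S) →ₗ[R] ∀ S, K.obj S :=
  K.restrict (e ∈ ·) ∘ₗ K.diffOn (insert e B)

theorem diffOn_insert (he : e ∉ B) (x : ∀ S, K.obj S) :
    K.diffOn (insert e B) x = K.diffInsert B e x + K.diffOn B x := by
  funext S
  rw [Pi.add_apply, diffInsert, LinearMap.comp_apply]
  by_cases heS : e ∈ S
  · rw [restrict_of_pos (e ∈ ·) heS, diffOn_of_not_subset fun h => he (h heS), add_zero]
  rw [restrict_of_neg (e ∈ ·) heS, zero_add]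
  by_cases hS : S ⊆ B
  · rw [diffOn_of_subset hS, diffOn_of_subset (hS.trans (B.subset_insert e))]
  · rw [diffOn_of_not_subset hS,
      diffOn_of_not_subset ((Finset.subset_insert_iff_of_notMem heS).not.2 hS)]

theorem diffOn_diffInsert (he : e ∉ B) (x : ∀ S, K.obj S) :
    K.diffOn (insert e B) (K.diffInsert B e x) = -K.diffInsert B e (K.diffOn B x) := by
  have h := diffOn_diffOn (insert e B) x
  rw [diffOn_insert he x, map_add, diffOn_insert he (K.diffOn B x), diffOn_diffOn,
    add_zero] at h
  exact eq_neg_of_add_eq_zero_left h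

theorem diffInsert_of_notMem {S : Finset E} (heS : e ∉ S) (x : ∀ S, K.obj S) :
    K.diffInsert B e x S = 0 :=
  restrict_of_neg (e ∈ ·) heS _

theorem diffInsert_insert {i : ℤ} (he : e ∉ B) {x : ∀ S, K.obj S} (hx : x ∈ K.chainOn A B i j)
    {S : Finset E} (heS : e ∉ S) : K.diffInsert B e x (insert e S) =
      edgeSign S e • K.map (Finset.subset_insert e S) (x S) := by
  rw [diffInsert, LinearMap.comp_apply, restrict_of_pos (e ∈ ·) (S.mem_insert_self e)]
  by_cases hS : S ⊆ B
  · rw [diffOn_of_subset (Finset.insert_subset_insert e hS), diff_apply,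
      Finset.sum_eq_single_of_mem e (S.mem_insert_self e),
      K.map_congr x (Finset.erase_insert heS), Finset.erase_insert heS]
    intro f _ hfe
    rw [eq_zero_of_mem_chainOn hx, map_zero, smul_zero]
    exact fun h => he (h.2 (Finset.mem_erase.2 ⟨hfe.symm, S.mem_insert_self e⟩))
  · rw [diffOn_of_not_subset, eq_zero_of_mem_chainOn hx fun h => hS h.2, map_zero, smul_zero]
    exact fun h => hS ((Finset.insert_subset_insert_iff heS).1 h)

theorem edgeSign_smul_edgeSign_smul {V : Type*} [AddCommGroup V] (S : Finset E) (e : E) (x : V) :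
    edgeSign S e • edgeSign S e • x = x := by
  rw [smul_smul, edgeSign, ← mul_pow, neg_one_mul, neg_neg, one_pow, one_smul]

theorem diffInsert_eq_zero_iff {i : ℤ} (he : e ∉ B) {x : ∀ S, K.obj S}
    (hx : x ∈ K.chainOn A B i j) :
    K.diffInsert B e x = 0 ↔ ∀ S ⊆ B, K.map (Finset.subset_insert e S) (x S) = 0 := by
  constructor
  · intro h S hS
    rw [← edgeSign_smul_edgeSign_smul S e (K.map _ (x S)),
      ← diffInsert_insert he hx fun heS => he (hS heS), h, Pi.zero_apply, smul_zero]
  · refine fun h => funext fun S => ?_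
    by_cases heS : e ∈ S
    · rw [← Finset.insert_erase heS, diffInsert_insert he hx (S.notMem_erase e)]
      by_cases hS : S.erase e ⊆ B
      · rw [h _ hS, smul_zero, Pi.zero_apply]
      · rw [eq_zero_of_mem_chainOn hx fun h => hS h.2, map_zero, smul_zero, Pi.zero_apply]
    · exact diffInsert_of_notMem heS x

theorem exists_diffInsert_eq (heA : e ∉ A) (heB : e ∉ B)
    (hsurj : ∀ S, A ⊆ S → S ⊆ B → ∀ y ∈ K.deg j (insert e S), ∃ x ∈ K.deg j S,
      K.map (Finset.subset_insert e S) x = y) {i : ℤ} {x : ∀ S, K.obj S}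
    (hx : x ∈ K.chainOn A (insert e B) (i + 1) j) :
    ∃ a ∈ K.chainOn A B i j, K.diffInsert B e a = K.restrict (e ∈ ·) x := by
  obtain ⟨a, ha, hax⟩ := exists_mem_chainOn (i := i) fun S _ hAS hSB =>
    hsurj S hAS hSB (edgeSign S e • x (insert e S)) (zsmul_mem (mem_chainOn.1 hx _).1 _)
  refine ⟨a, ha, funext fun T => ?_⟩
  by_cases heT : e ∈ T
  · obtain ⟨S, heS, rfl⟩ : ∃ S, e ∉ S ∧ insert e S = T :=
      ⟨T.erase e, T.notMem_erase e, Finset.insert_erase heT⟩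
    rw [diffInsert_insert heB ha heS, restrict_of_pos (e ∈ ·) heT]
    by_cases hS : (S.card : ℤ) = i ∧ A ⊆ S ∧ S ⊆ B
    · rw [hax S hS.1 hS.2.1 hS.2.2, edgeSign_smul_edgeSign_smul]
    · have hxS : x (insert e S) = 0 := not_imp_comm.1 (mem_chainOn.1 hx _).2 fun h => hS
        ⟨by simpa [heS] using h.1, (Finset.subset_insert_iff_of_notMem heA).1 h.2.1,
          (Finset.insert_subset_insert_iff heS).1 h.2.2⟩
      rw [not_imp_comm.1 (mem_chainOn.1 ha S).2 hS, map_zero, smul_zero, hxS]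
  · rw [diffInsert_of_notMem heT, restrict_of_neg (e ∈ ·) heT]

theorem IsConcentratedOn.of_ker_diffInsert [IsDomain R] [∀ S, Module.IsTorsionFree R (K.obj S)]
    (heA : e ∉ A) (heB : e ∉ B)
    (hsurj : ∀ S, A ⊆ S → S ⊆ B → ∀ y ∈ K.deg j (insert e S), ∃ x ∈ K.deg j S,
      K.map (Finset.subset_insert e S) x = y)
    (hker : IsConcentrated (K.diffOn (insert e B))
      (fun i => K.chainOn A B i j ⊓ LinearMap.ker (K.diffInsert B e)) k) :
    K.IsConcentratedOn A (insert e B) j k := by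
  refine .of_subcomplex_ker (K.isDifferential_diffOn A _ j) (K.restrict (e ∈ ·)) ?_
    (by simpa only [← inf_assoc, chainOn_inf_ker_restrict_mem heB, diffInsert] using hker)
  intro i x hx
  obtain ⟨a, ha, hax⟩ := exists_diffInsert_eq (i := i - 1) heA heB hsurj (by rwa [sub_add_cancel])
  rw [← chainOn_inf_ker_restrict_mem heB] at ha
  exact ⟨a, ha.1, hax⟩

theorem IsConcentratedOn.of_bijective [IsDomain R] [∀ S, Module.IsTorsionFree R (K.obj S)]
    (heA : e ∉ A) (heB : e ∉ B)
    (hinj : ∀ S, A ⊆ S → Function.Injective (K.map (Finset.subset_insert e S)))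
    (hsurj : ∀ S, A ⊆ S → S ⊆ B → ∀ y ∈ K.deg j (insert e S), ∃ x ∈ K.deg j S,
      K.map (Finset.subset_insert e S) x = y) :
    K.IsConcentratedOn A (insert e B) j k := by
  refine .of_ker_diffInsert heA heB hsurj (.of_eq_bot fun i => (Submodule.eq_bot_iff _).2 ?_)
  rintro x ⟨hx, hker⟩
  funext S
  by_cases hS : A ⊆ S ∧ S ⊆ B
  · refine hinj S hS.1 ?_
    rw [(diffInsert_eq_zero_iff heB hx).1 hker S hS.2, Pi.zero_apply, map_zero]
  · exact eq_zero_of_mem_chainOn hx hS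

/-- An operator of degree one on the part of the cube `K` below `B`, exact in the sense that its
image is the kernel of the map which inserts `e`. The model is exterior multiplication by the
vector represented by `e`. -/
structure IsKoszul (K : GradedCube R E) (m : ∀ S, K.obj S →ₗ[R] K.obj S) (B : Finset E) (e : E) :
    Prop where
  mem : ∀ {S}, S ⊆ B → ∀ {j x}, x ∈ K.deg j S → m S x ∈ K.deg (j + 1) S
  map : ∀ {S T} (h : S ⊆ T), T ⊆ B → ∀ x, m T (K.map h x) = K.map h (m S x)
  sq_eq_zero : ∀ {S}, S ⊆ B → ∀ x, m S (m S x) = 0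
  map_eq_zero : ∀ {S}, S ⊆ B → ∀ {j x}, x ∈ K.deg j S → m S x = 0 →
    K.map (Finset.subset_insert e S) x = 0
  exact : ∀ {S}, S ⊆ B → ∀ {j x}, x ∈ K.deg j S → K.map (Finset.subset_insert e S) x = 0 →
    ∃ y ∈ K.deg (j - 1) S, m S y = x

namespace IsKoszul

variable {m : ∀ S, K.obj S →ₗ[R] K.obj S}

theorem map_apply_eq_zero (hm : K.IsKoszul m B e) {S : Finset E} (hS : S ⊆ B) {x : K.obj S}
    (hx : x ∈ K.deg j S) : K.map (Finset.subset_insert e S) (m S x) = 0 :=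
  hm.map_eq_zero hS (hm.mem hS hx) (hm.sq_eq_zero hS x)

theorem apply_eq_zero_iff (hm : K.IsKoszul m B e) {S : Finset E} (hS : S ⊆ B) {x : K.obj S}
    (hx : x ∈ K.deg j S) : m S x = 0 ↔ K.map (Finset.subset_insert e S) x = 0 := by
  refine ⟨hm.map_eq_zero hS hx, fun h => ?_⟩
  obtain ⟨y, -, rfl⟩ := hm.exact hS hx h
  exact hm.sq_eq_zero hS y

theorem piMap_eq_zero_iff (hm : K.IsKoszul m B e) (he : e ∉ B) {i : ℤ} {x : ∀ S, K.obj S}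
    (hx : x ∈ K.chainOn A B i j) : LinearMap.piMap m x = 0 ↔ K.diffInsert B e x = 0 := by
  rw [diffInsert_eq_zero_iff he hx, funext_iff]
  refine forall_congr' fun S => ?_
  change m S (x S) = 0 ↔ _
  by_cases hS : S ⊆ B
  · simp only [hS, forall_const, hm.apply_eq_zero_iff hS (mem_chainOn.1 hx S).1]
  · simp only [hS, eq_zero_of_mem_chainOn hx fun h => hS h.2, map_zero, IsEmpty.forall_iff]

theorem map_piMap_chainOn (hm : K.IsKoszul m B e) (he : e ∉ B) (i : ℤ) :
    (K.chainOn A B i (j - 1)).map (LinearMap.piMap m) =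
      K.chainOn A B i j ⊓ LinearMap.ker (K.diffInsert B e) := by
  ext x
  constructor
  · rintro ⟨x, hx, rfl⟩
    have hmx : LinearMap.piMap m x ∈ K.chainOn A B i j := mem_chainOn.2 fun S => by
      change m S (x S) ∈ _ ∧ (m S (x S) ≠ 0 → _)
      have hS := mem_chainOn.1 hx S
      by_cases hxS : x S = 0
      · simp [hxS]
      · exact ⟨by simpa using hm.mem (hS.2 hxS).2.2 hS.1, fun _ => hS.2 hxS⟩
    exact ⟨hmx, (diffInsert_eq_zero_iff he hmx).2 fun S hS =>
      hm.map_apply_eq_zero hS (mem_chainOn.1 hx S).1⟩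
  · rintro ⟨hx, hker⟩
    obtain ⟨y, hy, hyx⟩ := exists_mem_chainOn (i := i) (A := A) fun S _ _ hSB =>
      hm.exact hSB (mem_chainOn.1 hx S).1 ((diffInsert_eq_zero_iff he hx).1 hker S hSB)
    refine ⟨y, hy, funext fun S => ?_⟩
    by_cases hS : (S.card : ℤ) = i ∧ A ⊆ S ∧ S ⊆ B
    · exact hyx S hS.1 hS.2.1 hS.2.2
    · change m S (y S) = x S
      rw [not_imp_comm.1 (mem_chainOn.1 hy S).2 hS, map_zero,
        not_imp_comm.1 (mem_chainOn.1 hx S).2 hS]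

theorem diffOn_piMap (hm : K.IsKoszul m B e) (he : e ∉ B) {i : ℤ} {x : ∀ S, K.obj S}
    (hx : x ∈ K.chainOn A B i (j - 1)) :
    K.diffOn (insert e B) (LinearMap.piMap m x) = LinearMap.piMap m (K.diffOn B x) := by
  have hker := ((hm.map_piMap_chainOn he i).le ⟨x, hx, rfl⟩).2
  rw [diffOn_insert he, LinearMap.mem_ker.1 hker, zero_add]
  funext S
  change _ = m S (K.diffOn B x S)
  by_cases hS : S ⊆ B
  · rw [diffOn_of_subset hS, diffOn_of_subset hS, diff_apply, diff_apply, map_sum]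
    refine Finset.sum_congr rfl fun f _ => ?_
    rw [map_zsmul, hm.map _ hS]
    rfl
  · rw [diffOn_of_not_subset hS, diffOn_of_not_subset hS, map_zero]

end IsKoszul

theorem map_diffInsert_chainOn (heA : e ∉ A) (heB : e ∉ B)
    (hsurj : ∀ S, A ⊆ S → S ⊆ B → ∀ y ∈ K.deg j (insert e S), ∃ x ∈ K.deg j S,
      K.map (Finset.subset_insert e S) x = y) (i : ℤ) :
    (K.chainOn A B i j).map (K.diffInsert B e) = K.chainOn (insert e A) (insert e B) (i + 1) j := by
  ext y
  rw [← chainOn_inf_ker_restrict_notMem]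
  constructor
  · rintro ⟨x, hx, rfl⟩
    have hx' := (K.isDifferential_diffOn A (insert e B) j).mem i x
      ((chainOn_inf_ker_restrict_mem heB i j).ge hx).1
    refine ⟨?_, ?_⟩
    · rw [SetLike.mem_coe, ← add_sub_cancel_right (K.diffInsert B e x) (K.diffOn B x),
        ← diffOn_insert heB]
      exact sub_mem hx' ((chainOn_inf_ker_restrict_mem heB _ j).ge
        ((K.isDifferential_diffOn A B j).mem i x hx)).1
    · funext S
      by_cases heS : e ∈ S
      · exact restrict_of_neg (e ∉ ·) (not_not.2 heS) _
      · exact (restrict_of_pos (e ∉ ·) heS _).trans (diffInsert_of_notMem heS x)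
  · rintro ⟨hy, hker⟩
    obtain ⟨a, ha, hay⟩ := exists_diffInsert_eq heA heB hsurj hy
    refine ⟨a, ha, hay.trans (funext fun S => ?_)⟩
    by_cases heS : e ∈ S
    · exact restrict_of_pos (e ∈ ·) heS y
    · rw [restrict_of_neg (e ∈ ·) heS, ← restrict_of_pos (e ∉ ·) heS y]
      exact (congrFun hker S).symm

theorem IsConcentratedOn.of_isKoszul [IsDomain R] [∀ S, Module.IsTorsionFree R (K.obj S)]
    {m : ∀ S, K.obj S →ₗ[R] K.obj S} (hm : K.IsKoszul m B e) (heA : e ∉ A) (heB : e ∉ B)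
    (hsurj : ∀ j S, A ⊆ S → S ⊆ B → ∀ y ∈ K.deg j (insert e S), ∃ x ∈ K.deg j S,
      K.map (Finset.subset_insert e S) x = y)
    (h : K.IsConcentratedOn (insert e A) (insert e B) (j - 1) (k + 1)) :
    K.IsConcentratedOn A (insert e B) j k :=
  .of_ker_diffInsert heA heB (hsurj j) <|
    .of_span (K.isDifferential_diffOn A B (j - 1)) (LinearMap.piMap m) (K.diffInsert B e)
      (hm.map_piMap_chainOn heB) (map_diffInsert_chainOn heA heB (hsurj (j - 1)))
      (fun _ _ => hm.piMap_eq_zero_iff heB) (fun _ _ => hm.diffOn_piMap heB)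
      (fun _ x _ => diffOn_diffInsert heB x) h

end DeletionContraction

/-- The properties of the cubes attached to a matroid `M` which determine in which degree their
cohomology is concentrated. -/
structure IsMatroidal (K : GradedCube R E) (M : Matroid E) : Prop where
  ground_eq : M.E = Set.univ
  eq_zero : ∀ {S : Finset E}, M.Spanning S → ∀ {j x}, j ≠ 0 → x ∈ K.deg j S → x = 0
  exists_map_eq : ∀ S e j, ∀ y ∈ K.deg j (insert e S), ∃ x ∈ K.deg j S,
    K.map (Finset.subset_insert e S) x = y
  map_injective : ∀ {S : Finset E} {e}, e ∈ M.closure S →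
    Function.Injective (K.map (Finset.subset_insert e S))
  exists_isKoszul : ∀ {S : Finset E} {e}, e ∉ M.closure S → ∃ m, K.IsKoszul m S e

theorem IsMatroidal.isConcentratedOn_self {M : Matroid E} [IsDomain R]
    [∀ S, Module.IsTorsionFree R (K.obj S)] (hK : K.IsMatroidal M) {A : Finset E}
    (hA : M.Spanning A) {j k : ℤ} (hk : j = 0 → k = A.card) : K.IsConcentratedOn A A j k := by
  have hbot {i} (hi : i ≠ k) {x} (hx : x ∈ K.chainOn A A i j) : x = 0 := by
    funext S
    by_contra hxS
    obtain ⟨hS, hAS, hSA⟩ := (mem_chainOn.1 hx S).2 hxS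
    obtain rfl := hAS.antisymm hSA
    refine hxS (hK.eq_zero hA (fun hj => hi ?_) (mem_chainOn.1 hx A).1)
    rw [← hS, hk hj]
  refine ⟨fun i hi x hx _ => ⟨0, zero_mem _, by rw [map_zero, hbot hi hx]⟩,
    fun n hn x _ y hy hyx => ⟨0, zero_mem _, ?_⟩⟩
  rw [hbot (by omega) hy, map_zero, eq_comm, smul_eq_zero] at hyx
  rw [map_zero, hyx.resolve_left hn]

theorem spanning_of_spanning_insert {α : Type*} {M : Matroid α} {X : Set α} {e : α}
    (hX : X ⊆ M.E) (he : e ∈ M.closure X) (h : M.Spanning (insert e X)) : M.Spanning X := by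
  rw [M.spanning_iff_closure_eq hX, ← M.closure_insert_eq_of_mem_closure he]
  exact h.closure_eq

theorem card_insert_sdiff {A C : Finset E} {e : E} (heA : e ∉ A) (heC : e ∉ C) :
    (insert e C \ A).card = (C \ A).card + 1 := by
  rw [Finset.insert_sdiff_of_notMem _ heA, Finset.card_insert_of_notMem (by simp [heC])]

theorem IsMatroidal.isConcentratedOn {M : Matroid E} [IsDomain R]
    [∀ S, Module.IsTorsionFree R (K.obj S)] (hK : K.IsMatroidal M) {r : ℕ} (hr : M.eRank = r)
    {A B : Finset E} (hAB : A ⊆ B) (hB : M.Spanning B) {a : ℕ} (ha : M.eRk A = a) (j : ℤ) :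
    K.IsConcentratedOn A B j (A.card + r - a - j) := by
  induction hn : (B \ A).card generalizing A B a j with
  | zero =>
    obtain rfl : A = B :=
      hAB.antisymm (Finset.sdiff_eq_empty_iff_subset.1 (Finset.card_eq_zero.1 hn))
    have har : a = r := by
      rw [hB.eRk_eq, hr] at ha
      exact_mod_cast ha.symm
    exact hK.isConcentratedOn_self hB fun hj => by omega
  | succ n ih =>
    obtain ⟨e, he⟩ : (B \ A).Nonempty := Finset.card_pos.1 (by omega)
    obtain ⟨heB, heA⟩ := Finset.mem_sdiff.1 he
    obtain ⟨C, heC, rfl⟩ : ∃ C, e ∉ C ∧ insert e C = B :=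
      ⟨B.erase e, B.notMem_erase e, Finset.insert_erase heB⟩
    have hAC : A ⊆ C := (Finset.subset_insert_iff_of_notMem heA).1 hAB
    have hcard : (C \ A).card = n := Nat.succ.inj ((card_insert_sdiff heA heC).symm.trans hn)
    have hcard' : (insert e C \ insert e A).card = n := by
      rw [Finset.insert_sdiff_insert, Finset.sdiff_insert_of_notMem heC, hcard]
    by_cases heclA : e ∈ M.closure A
    · exact .of_bijective heA heC (fun S hS => hK.map_injective
        (M.closure_subset_closure (Finset.coe_subset.2 hS) heclA))
        fun S _ _ => hK.exists_map_eq S e j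
    have hrk : M.eRk (insert e A : Finset E) = (a + 1 : ℕ) := by
      rw [Finset.coe_insert, M.eRk_insert_eq_add_one ⟨hK.ground_eq ▸ Set.mem_univ e, heclA⟩, ha,
        Nat.cast_succ]
    have hcontract j := ih (Finset.insert_subset_insert e hAC) hB hrk j hcard'
    rw [Finset.card_insert_of_notMem heA] at hcontract
    by_cases heclC : e ∈ M.closure C
    · refine .of_contract_of_delete heC ?_ (ih hAC ?_ ha j hcard)
      · convert hcontract j using 1
        push_cast
        ring
      · rw [Finset.coe_insert] at hB
        exact spanning_of_spanning_insert (hK.ground_eq ▸ Set.subset_univ _) heclC hB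
    · obtain ⟨m, hm⟩ := hK.exists_isKoszul heclC
      refine .of_isKoszul hm heA heC (fun j S _ _ => hK.exists_map_eq S e j) ?_
      convert hcontract (j - 1) using 1
      push_cast
      ring

theorem complex_d_apply (K : GradedCube R E) (j : ℤ) {i i' : ℤ} (h : i + 1 = i')
    (x : K.chain i j) : (((K.complex j).d i i').hom x : K.chain i' j) =
      ⟨K.diff x, K.diff_mem h j x x.2⟩ := by
  simp only [complex, dif_pos h]
  rfl

theorem IsMatroidal.nonempty_complex_iso [Finite E] [IsDomain R] [IsPrincipalIdealRing R]
    {M : Matroid E} {K' : GradedCube R E} (hK : K.IsMatroidal M) (hK' : K'.IsMatroidal M)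
    (hfin : ∀ S, Module.Finite R (K.obj S)) (hfree : ∀ S, Module.Free R (K.obj S))
    (hfin' : ∀ S, Module.Finite R (K'.obj S)) (hfree' : ∀ S, Module.Free R (K'.obj S))
    (j : ℤ) (hrank : ∀ i, Module.finrank R (K.chain i j) = Module.finrank R (K'.chain i j)) :
    Nonempty (K.complex j ≅ K'.complex j) := by
  have := Fintype.ofFinite E
  obtain ⟨r, hr⟩ := ENat.ne_top_iff_exists.1 (M.eRank_ne_top_iff.2 inferInstance)
  have hspan : M.Spanning (Finset.univ : Finset E) := by
    rw [Finset.coe_univ, ← hK.ground_eq]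
    exact M.ground_spanning
  have hrk : M.eRk (∅ : Finset E) = (0 : ℕ) := by simp
  have hconc := hK.isConcentratedOn hr.symm (Finset.empty_subset _) hspan hrk j
  have hconc' := hK'.isConcentratedOn hr.symm (Finset.empty_subset _) hspan hrk j
  have hdiff := K.isDifferential_diffOn ∅ Finset.univ j
  have hdiff' := K'.isDifferential_diffOn ∅ Finset.univ j
  simp only [IsConcentratedOn, chainOn_empty_univ, diffOn_univ] at hconc hconc' hdiff hdiff'
  obtain ⟨φ, hφ⟩ := hconc.exists_linearEquiv hdiff hconc' hdiff' hrank fun i hi =>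
    K.chain_eq_bot hi j
  refine ⟨HomologicalComplex.Hom.isoOfComponents (fun i => (φ i).toModuleIso) ?_⟩
  rintro i _ rfl
  ext x
  refine Subtype.ext ((congrArg Subtype.val (K'.complex_d_apply j rfl (φ i x))).trans ?_)
  exact (hφ i x).symm.trans
    (congrArg (fun y => (φ (i + 1) y : ∀ S, K'.obj S)) (K.complex_d_apply j rfl x).symm)

end Subcube

section ComplexMap

variable {R E : Type*} [CommRing R] {K K' K'' : GradedCube R E} {j j' j'' : ℤ}
  {f : ∀ S, K.obj S →ₗ[R] K'.obj S} {g : ∀ S, K'.obj S →ₗ[R] K''.obj S}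

theorem mem_map_piMap_chain {i : ℤ} {y : ∀ S, K'.obj S} :
    y ∈ (K.chain i j).map (LinearMap.piMap f) ↔
      ∀ S, y S ∈ (K.deg j S).map (f S) ∧ ((S.card : ℤ) ≠ i → y S = 0) := by
  constructor
  · rintro ⟨x, hx, rfl⟩ S
    exact ⟨⟨x S, (hx S).1, rfl⟩, fun hS => (congrArg (f S) ((hx S).2 hS)).trans (map_zero _)⟩
  · intro hy
    choose x hx hxy using fun S => (hy S).1
    refine ⟨fun S => if (S.card : ℤ) = i then x S else 0, fun S => ?_, funext fun S => ?_⟩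
    · dsimp only
      split_ifs with hS
      · exact ⟨hx S, fun h => absurd hS h⟩
      · exact ⟨zero_mem _, fun _ => rfl⟩
    · change f S (ite _ _ _) = y S
      split_ifs with hS
      · exact hxy S
      · rw [map_zero, (hy S).2 hS]

theorem map_piMap_chain (hdeg : ∀ S, (K.deg j S).map (f S) = K'.deg j' S) (i : ℤ) :
    (K.chain i j).map (LinearMap.piMap f) = K'.chain i j' := by
  ext y
  simp only [mem_map_piMap_chain, hdeg]
  rfl

variable [LinearOrder E]

theorem diff_piMap (hf : ∀ S T (h : S ⊆ T) x, f T (K.map h x) = K'.map h (f S x))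
    (x : ∀ S, K.obj S) : K'.diff (LinearMap.piMap f x) = LinearMap.piMap f (K.diff x) := by
  funext T
  change _ = f T (K.diff x T)
  simp only [diff_apply, map_sum, map_zsmul, hf]
  rfl

variable (f) in
/-- The cochain map `C^{•,j} → C^{•,j'}` given by maps between the vertices of two cubes which
commute with the maps along the edges and carry degree `j` to degree `j'`. -/
def complexMap (hf : ∀ S T (h : S ⊆ T) x, f T (K.map h x) = K'.map h (f S x))
    (hdeg : ∀ S, (K.deg j S).map (f S) ≤ K'.deg j' S) : K.complex j ⟶ K'.complex j' where
  f i := ModuleCat.ofHom <| (LinearMap.piMap f).restrict (p := K.chain i j) (q := K'.chain i j')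
    fun x hx S => ⟨hdeg S ⟨x S, (hx S).1, rfl⟩,
      fun hS => (congrArg (f S) ((hx S).2 hS)).trans (map_zero _)⟩
  comm' i i' h := by
    refine ModuleCat.hom_ext (LinearMap.ext fun x => (complex_d_apply K' j' h _).trans ?_)
    refine Subtype.ext ((diff_piMap hf x.1).trans ?_)
    exact congrArg (fun y : K.chain i' j => LinearMap.piMap f y.1) (complex_d_apply K j h x).symm

variable {hf : ∀ S T (h : S ⊆ T) x, f T (K.map h x) = K'.map h (f S x)}
  {hg : ∀ S T (h : S ⊆ T) x, g T (K'.map h x) = K''.map h (g S x)}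
  {hfdeg : ∀ S, (K.deg j S).map (f S) ≤ K'.deg j' S}
  {hgdeg : ∀ S, (K'.deg j' S).map (g S) ≤ K''.deg j'' S}

theorem map_range_complexMap (i : ℤ) :
    (LinearMap.range ((complexMap f hf hfdeg).f i).hom).map (K'.chain i j').subtype =
      (K.chain i j).map (LinearMap.piMap f) := by
  ext y
  constructor
  · rintro ⟨_, ⟨x, rfl⟩, rfl⟩
    exact ⟨x.1, x.2, rfl⟩
  · rintro ⟨x, hx, rfl⟩
    exact ⟨_, ⟨⟨x, hx⟩, rfl⟩, rfl⟩

theorem map_ker_complexMap (i : ℤ) :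
    (LinearMap.ker ((complexMap f hf hfdeg).f i).hom).map (K.chain i j).subtype =
      K.chain i j ⊓ LinearMap.ker (LinearMap.piMap f) := by
  ext x
  constructor
  · rintro ⟨x, hx, rfl⟩
    exact ⟨x.2, congrArg Subtype.val hx⟩
  · rintro ⟨hx, hfx⟩
    exact ⟨⟨x, hx⟩, Subtype.ext hfx, rfl⟩

theorem complexMap_comp_eq_zero
    (hfg : ∀ S, (K.deg j S).map (f S) = K'.deg j' S ⊓ LinearMap.ker (g S)) :
    complexMap f hf hfdeg ≫ complexMap g hg hgdeg = 0 := by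
  ext i x
  refine Subtype.ext (funext fun S => ?_)
  exact ((hfg S).le ⟨x.1 S, (x.2 S).1, rfl⟩).2

theorem shortExact_complexMap (hinj : ∀ S, Function.Injective (f S))
    (hfg : ∀ S, (K.deg j S).map (f S) = K'.deg j' S ⊓ LinearMap.ker (g S))
    (hsurj : ∀ S, (K'.deg j' S).map (g S) = K''.deg j'' S) :
    (ShortComplex.mk (complexMap f hf hfdeg) (complexMap g hg hgdeg)
      (complexMap_comp_eq_zero hfg)).ShortExact := by
  refine HomologicalComplex.shortExact_of_degreewise_shortExact _ fun i => ?_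
  refine .mk' ?_ ((ModuleCat.mono_iff_injective _).2 ?_) ((ModuleCat.epi_iff_surjective _).2 ?_)
  · refine (ShortComplex.moduleCat_exact_iff _).2 fun y hy => ?_
    obtain ⟨x, hx, hxy⟩ := mem_map_piMap_chain.2 fun S =>
      ⟨(hfg S).ge ⟨(y.2 S).1, congrFun (congrArg Subtype.val hy) S⟩, (y.2 S).2⟩
    exact ⟨⟨x, hx⟩, Subtype.ext hxy⟩
  · exact fun x y hxy => Subtype.ext <| Function.Injective.piMap hinj <| congrArg Subtype.val hxy
  · intro z
    obtain ⟨y, hy, hyz⟩ := (map_piMap_chain hsurj i).ge z.2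
    exact ⟨⟨y, hy⟩, Subtype.ext hyz⟩

end ComplexMap

end GradedCube

/-! ### The characteristic complex -/

section Exterior

variable {R : Type*} [CommRing R] {N : Type*} [AddCommGroup N] [Module R N] {j : ℤ}
  {x : ExteriorAlgebra R N}

open ExteriorAlgebra CliffordAlgebra

theorem ι_mul_mem_exteriorDegree (v : N) (hx : x ∈ exteriorDegree R N j) :
    ι R v * x ∈ exteriorDegree R N (j + 1) := by
  cases j with
  | ofNat n =>
    change _ ∈ ⋀[R]^(n + 1) N
    rw [exteriorPower, pow_succ']
    exact Submodule.mul_mem_mul (LinearMap.mem_range_self _ _) hx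
  | negSucc n =>
    rw [(Submodule.mem_bot R).1 hx, mul_zero]
    exact zero_mem _

theorem contractLeft_mem_exteriorPower (f : Module.Dual R N) {n : ℕ} {x : ExteriorAlgebra R N}
    (hx : x ∈ ⋀[R]^(n + 1) N) : contractLeft f x ∈ ⋀[R]^n N := by
  induction n generalizing x with
  | zero =>
    rw [exteriorPower, zero_add, pow_one] at hx
    obtain ⟨v, rfl⟩ := hx
    rw [contractLeft_ι, exteriorPower, pow_zero]
    exact Submodule.algebraMap_mem _
  | succ n ih =>
    rw [exteriorPower, pow_succ'] at hx
    induction hx using Submodule.mul_induction_on' with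
    | mem_mul_mem v hv y hy =>
      obtain ⟨v, rfl⟩ := hv
      rw [contractLeft_ι_mul]
      exact sub_mem (Submodule.smul_mem _ _ hy) (ι_mul_mem_exteriorDegree (j := n) v (ih hy))
    | add a _ b _ ha hb =>
      rw [map_add]
      exact add_mem ha hb

theorem contractLeft_mem_exteriorDegree (f : Module.Dual R N) (hx : x ∈ exteriorDegree R N j) :
    contractLeft f x ∈ exteriorDegree R N (j - 1) := by
  match j, hx with
  | Int.negSucc n, hx =>
    rw [(Submodule.mem_bot R).1 hx, map_zero]
    exact zero_mem _
  | Int.ofNat 0, hx =>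
    obtain ⟨r, rfl⟩ := Submodule.mem_one.1 ((pow_zero (LinearMap.range (ι R : N →ₗ[R] _))).le hx)
    rw [contractLeft_algebraMap]
    exact zero_mem _
  | Int.ofNat (n + 1), hx =>
    rw [Int.ofNat_eq_natCast, Nat.cast_succ, add_sub_cancel_right]
    exact contractLeft_mem_exteriorPower f hx

theorem eq_zero_of_mem_exteriorDegree [Subsingleton N] (hj : j ≠ 0)
    (hx : x ∈ exteriorDegree R N j) : x = 0 := by
  match j, hx with
  | Int.negSucc _, hx => exact hx
  | Int.ofNat 0, _ => exact absurd rfl hj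
  | Int.ofNat (n + 1), hx =>
    have hx : x ∈ LinearMap.range (ι R : N →ₗ[R] _) ^ (n + 1) := hx
    rwa [Subsingleton.elim (ι R) 0, LinearMap.range_zero, pow_succ', Submodule.bot_mul,
      Submodule.mem_bot] at hx

theorem ι_mul_ι_mul (v : N) (x : ExteriorAlgebra R N) : ι R v * (ι R v * x) = 0 := by
  rw [← mul_assoc, ι_sq_zero, zero_mul]

theorem ι_mul_contractLeft_add {f : Module.Dual R N} {v : N} (hfv : f v = 1)
    (x : ExteriorAlgebra R N) : ι R v * contractLeft f x + contractLeft f (ι R v * x) = x := by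
  rw [contractLeft_ι_mul, hfv, one_smul, add_sub_cancel]

theorem exteriorMap_id_sub_smulRight (f : Module.Dual R N) (v : N) (x : ExteriorAlgebra R N) :
    ExteriorAlgebra.map (LinearMap.id - f.smulRight v) x = x - ι R v * contractLeft f x := by
  induction x using CliffordAlgebra.left_induction with
  | algebraMap r =>
    rw [contractLeft_algebraMap, mul_zero, sub_zero]
    exact AlgHom.commutes _ r
  | add x y hx hy => rw [map_add, hx, hy, map_add, mul_add, add_sub_add_comm]
  | ι_mul x a hx =>
    have hswap : ι R a * (ι R v * contractLeft f x) = -(ι R v * (ι R a * contractLeft f x)) := by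
      rw [← mul_assoc, ← mul_assoc, eq_neg_of_add_eq_zero_left (ι_add_mul_swap a v), neg_mul]
    rw [map_mul, hx, ExteriorAlgebra.map_apply_ι, contractLeft_ι_mul,
      LinearMap.sub_apply, LinearMap.id_apply,
      LinearMap.smulRight_apply, map_sub, map_smul, sub_mul, mul_sub, mul_sub, mul_sub, hswap,
      smul_mul_assoc, smul_mul_assoc, ι_mul_ι_mul, smul_zero, mul_smul_comm]
    abel

variable {N' : Type*} [AddCommGroup N'] [Module R N'] {π : N →ₗ[R] N'} {f : Module.Dual R N} {v : N}

theorem exteriorMap_eq_zero_of_ι_mul_eq_zero (hfv : f v = 1) (hv : π v = 0)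
    (hx : ι R v * x = 0) : ExteriorAlgebra.map π x = 0 := by
  rw [← ι_mul_contractLeft_add hfv x, hx, map_zero, add_zero, map_mul,
    ExteriorAlgebra.map_apply_ι, hv, map_zero,
    zero_mul]

theorem ι_mul_contractLeft_of_exteriorMap_eq_zero {s : N' →ₗ[R] N}
    (hs : s ∘ₗ π = LinearMap.id - f.smulRight v) (hx : ExteriorAlgebra.map π x = 0) :
    ι R v * contractLeft f x = x := by
  rw [eq_comm, ← sub_eq_zero, ← exteriorMap_id_sub_smulRight, ← hs,
    ← ExteriorAlgebra.map_comp_map, AlgHom.comp_apply, hx, map_zero]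

theorem exists_dual_eq_one [IsDomain R] [Module.IsTorsionFree R N] [Module.Projective R N']
    (hπ : Function.Surjective π) (hker : LinearMap.ker π = R ∙ v) (hv : v ≠ 0) :
    ∃ f : Module.Dual R N, f v = 1 := by
  obtain ⟨s, hs⟩ := Module.projective_lifting_property π LinearMap.id hπ
  have hmem x : (LinearMap.id - s ∘ₗ π : N →ₗ[R] N) x ∈ R ∙ v := by
    rw [← hker, LinearMap.mem_ker, LinearMap.sub_apply, map_sub]
    exact sub_eq_zero.2 (LinearMap.congr_fun hs (π x)).symm
  have hπv : π v = 0 := by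
    rw [← LinearMap.mem_ker, hker]
    exact Submodule.mem_span_singleton_self v
  refine ⟨(LinearEquiv.toSpanNonzeroSingleton R N v hv).symm ∘ₗ
    (LinearMap.id - s ∘ₗ π).codRestrict _ hmem, ?_⟩
  rw [LinearMap.comp_apply, LinearEquiv.coe_coe, LinearEquiv.symm_apply_eq]
  ext
  simp [hπv]

theorem exists_comp_factor_eq {p q : Submodule R N} (hpq : p ≤ q) (hq : q = p ⊔ R ∙ v)
    (hfv : f v = 1) (hfp : p ≤ LinearMap.ker f) : ∃ s : (N ⧸ q) →ₗ[R] N ⧸ p,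
      s ∘ₗ Submodule.factor hpq = LinearMap.id - (p.liftQ f hfp).smulRight (p.mkQ v) := by
  have hle : q ≤ LinearMap.ker (p.mkQ ∘ₗ (LinearMap.id - f.smulRight v)) := by
    rw [hq, sup_le_iff, Submodule.span_singleton_le_iff_mem]
    refine ⟨fun x hx => ?_, by simp [hfv]⟩
    simpa [LinearMap.mem_ker.1 (hfp hx)] using hx
  exact ⟨q.liftQ _ hle, Submodule.linearMap_qext _ (LinearMap.ext fun x => by simp)⟩

theorem exists_exteriorMap_eq (hπ : Function.Surjective π) {y : ExteriorAlgebra R N'}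
    (hy : y ∈ exteriorDegree R N' j) :
    ∃ x ∈ exteriorDegree R N j, ExteriorAlgebra.map π x = y := by
  cases j with
  | ofNat n =>
    have h : (⋀[R]^n N).map (ExteriorAlgebra.map π).toLinearMap = ⋀[R]^n N' := by
      rw [exteriorPower, Submodule.map_pow, ExteriorAlgebra.ι_range_map_map,
        LinearMap.range_eq_top.2 hπ, Submodule.map_top]
    exact h.ge hy
  | negSucc n => exact ⟨0, zero_mem _, (map_zero _).trans ((Submodule.mem_bot R).1 hy).symm⟩

theorem exteriorMap_factor_factor {p q : Submodule R N} (h : p ≤ q) (h' : q ≤ p)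
    (x : ExteriorAlgebra R (N ⧸ p)) :
    ExteriorAlgebra.map (Submodule.factor h') (ExteriorAlgebra.map (Submodule.factor h) x) = x := by
  have hid : Submodule.factor (le_refl p) = LinearMap.id := Submodule.linearMap_qext _ rfl
  rw [← AlgHom.comp_apply, ExteriorAlgebra.map_comp_map, Submodule.factor_comp, hid,
    ExteriorAlgebra.map_id]
  rfl

end Exterior

section ExteriorBasis

variable {R M I : Type*} [CommRing R] [AddCommGroup M] [Module R M] [LinearOrder I]
  (b : Module.Basis I R M)

theorem basis_exteriorAlgebra_eq_prod_sort (Y : Finset I) :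
    b.ExteriorAlgebra Y = (Y.sort.map fun i => ExteriorAlgebra.ι R (b i)).prod := by
  rw [ExteriorAlgebra.basis_apply_ofCard b rfl, ExteriorAlgebra.ιMulti_family,
    ExteriorAlgebra.ιMulti_apply, ← Y.listMap_orderEmbOfFin_finRange rfl, List.map_map,
    List.ofFn_eq_map]
  rfl

theorem span_basis_exteriorAlgebra (j : ℤ) :
    Submodule.span R (b.ExteriorAlgebra '' {Y | (Y.card : ℤ) = j}) = exteriorDegree R M j := by
  cases j with
  | negSucc n =>
    refine Submodule.span_eq_bot.2 ?_
    rintro _ ⟨Y, hY, rfl⟩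
    exact absurd (Set.mem_ofPred_eq ▸ hY) (by omega)
  | ofNat n =>
    have hset : b.ExteriorAlgebra '' {Y | (Y.card : ℤ) = n} =
        (⋀[R]^n M).subtype '' Set.range (b.exteriorPower n) := by
      ext x
      constructor
      · rintro ⟨Y, hY, rfl⟩
        exact ⟨_, ⟨⟨Y, Nat.cast_injective hY⟩, rfl⟩,
          (ExteriorAlgebra.basis_eq_coe_basis b ⟨Y, Nat.cast_injective hY⟩).symm⟩
      · rintro ⟨_, ⟨Y, rfl⟩, rfl⟩
        exact ⟨Y, congrArg Nat.cast Y.2, ExteriorAlgebra.basis_eq_coe_basis b Y⟩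
    rw [Int.ofNat_eq_natCast, hset, ← Submodule.map_span, (b.exteriorPower n).span_eq,
      Submodule.map_top, Submodule.range_subtype]
    rfl

end ExteriorBasis

namespace QuasiRepresentation

variable {R : Type*} [CommRing R] [IsDomain R] [IsPrincipalIdealRing R] {N : Type*}
  [AddCommGroup N] [Module R N] [Module.Finite R N] {E : Type*} {M : Matroid E}
  (Q : QuasiRepresentation R N M)

open CliffordAlgebra (contractLeft)

theorem ρ_insert_eq {S : Set E} {e : E} (he : e ∈ M.closure S) : Q.ρ (insert e S) = Q.ρ S :=
  (Q.eq_of_rank_eq (Set.subset_insert e S) (by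
    rw [← M.eRk_closure_eq, ← M.eRk_closure_eq (insert e S),
      M.closure_insert_eq_of_mem_closure he])).symm

theorem ρ_insert_ne {S : Set E} {e : E} (he : e ∉ M.closure S) : Q.ρ (insert e S) ≠ Q.ρ S := by
  intro h
  have hrk := M.eRk_insert_eq_add_one (X := S) ⟨Q.ground_eq ▸ Set.mem_univ e, he⟩
  rw [← Q.finrank_eq, ← Q.finrank_eq, h] at hrk
  exact absurd (Nat.cast_injective hrk) (Nat.succ_ne_self _).symm

theorem ρ_eq_top {S : Set E} (hS : M.Spanning S) : Q.ρ S = ⊤ := by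
  rw [Q.eq_of_rank_eq (Set.subset_univ S), Q.univ]
  rw [hS.eRk_eq, ← Q.ground_eq, M.eRk_ground]

variable {Q} {m : E → N}

theorem ρ_insert (hm : ∀ S, Q.ρ S = Submodule.span R (m '' S)) (S : Set E) (e : E) :
    Q.ρ (insert e S) = Q.ρ S ⊔ R ∙ m e := by
  rw [hm, hm, Set.image_insert_eq, Submodule.span_insert, sup_comm]

theorem exists_dual_eq_one (hm : ∀ S, Q.ρ S = Submodule.span R (m '' S))
    [∀ S, Module.IsTorsionFree R (N ⧸ Q.ρ S)] {S : Set E} {e : E} (he : e ∉ M.closure S) :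
    ∃ f : Module.Dual R N, f (m e) = 1 ∧ Q.ρ S ≤ LinearMap.ker f := by
  have hle := Q.mono (Set.subset_insert e S)
  have hker : LinearMap.ker (Submodule.factor hle) = R ∙ (Q.ρ S).mkQ (m e) := by
    rw [Submodule.factor, Submodule.mapQ, Submodule.ker_liftQ, LinearMap.comp_id,
      Submodule.ker_mkQ, ρ_insert hm, Submodule.map_sup, Submodule.mkQ_map_self, bot_sup_eq,
      Submodule.map_span, Set.image_singleton]
  have hv : (Q.ρ S).mkQ (m e) ≠ 0 := fun h => Q.ρ_insert_ne he <| by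
    rwa [ρ_insert hm, sup_eq_left, Submodule.span_singleton_le_iff_mem, ← Submodule.ker_mkQ (Q.ρ S)]
  obtain ⟨f, hf⟩ := _root_.exists_dual_eq_one (Submodule.factor_surjective hle) hker hv
  exact ⟨f ∘ₗ (Q.ρ S).mkQ, hf, (Submodule.ker_mkQ _).ge.trans (LinearMap.ker_le_ker_comp _ _)⟩

theorem isKoszul_mulLeft [LinearOrder E] (hm : ∀ S, Q.ρ S = Submodule.span R (m '' S))
    {B : Finset E} {e : E} {f : Module.Dual R N} (hf : f (m e) = 1)
    (hfB : Q.ρ B ≤ LinearMap.ker f) : Q.cube.IsKoszul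
      (fun S => LinearMap.mulLeft R (ExteriorAlgebra.ι R ((Q.ρ S).mkQ (m e)))) B e where
  mem _ _ _ hx := ι_mul_mem_exteriorDegree _ hx
  map {S _} h _ (x : ExteriorAlgebra R (N ⧸ Q.ρ S)) := by
    change _ = ExteriorAlgebra.map (Submodule.factor (Q.mono (Finset.coe_subset.2 h)))
      (ExteriorAlgebra.ι R ((Q.ρ _).mkQ (m e)) * x)
    rw [map_mul, ExteriorAlgebra.map_apply_ι]
    rfl
  sq_eq_zero _ x := ι_mul_ι_mul _ x
  map_eq_zero {S} hS _ x _ := by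
    refine exteriorMap_eq_zero_of_ι_mul_eq_zero (v := (Q.ρ S).mkQ (m e))
      (f := (Q.ρ S).liftQ f ((Q.mono (Finset.coe_subset.2 hS)).trans hfB)) hf ?_
    rw [Submodule.factor_mk, Submodule.mkQ_apply, Submodule.Quotient.mk_eq_zero,
      Finset.coe_insert, ρ_insert hm]
    exact Submodule.mem_sup_right (Submodule.mem_span_singleton_self _)
  exact {S} hS j x hx hmap := by
    have hfS := (Q.mono (Finset.coe_subset.2 hS)).trans hfB
    obtain ⟨s, hs⟩ := exists_comp_factor_eq
      (Q.mono (Finset.coe_subset.2 (Finset.subset_insert e S)))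
      (by rw [Finset.coe_insert, ρ_insert hm]) hf hfS
    exact ⟨contractLeft ((Q.ρ S).liftQ f hfS) x, contractLeft_mem_exteriorDegree _ hx,
      ι_mul_contractLeft_of_exteriorMap_eq_zero hs hmap⟩

theorem isMatroidal_cube [LinearOrder E] [∀ S, Module.IsTorsionFree R (N ⧸ Q.ρ S)]
    (hm : ∀ S, Q.ρ S = Submodule.span R (m '' S)) : Q.cube.IsMatroidal M where
  ground_eq := Q.ground_eq
  eq_zero hS _ x hj hx := by
    have := Submodule.Quotient.subsingleton_iff.2 (Q.ρ_eq_top hS)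
    exact eq_zero_of_mem_exteriorDegree hj hx
  exists_map_eq S e _ _ hy := exists_exteriorMap_eq
    (Submodule.factor_surjective (Q.mono (Finset.coe_subset.2 (Finset.subset_insert e S)))) hy
  map_injective {S e} he := by
    have hle : Q.ρ (insert e S : Finset E) ≤ Q.ρ S := by rw [Finset.coe_insert, Q.ρ_insert_eq he]
    exact (Function.LeftInverse.injective (exteriorMap_factor_factor _ hle))
  exists_isKoszul he := by
    obtain ⟨f, hf, hfS⟩ := exists_dual_eq_one hm he
    exact ⟨_, isKoszul_mulLeft hm hf hfS⟩

end QuasiRepresentation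

/-! ### Labellings by `1` and `x` -/

/-- The free module on the labellings of `α` by `1` and `x`, a labelling `c` being encoded by the
finite set `c⁻¹(x)`. -/
abbrev Labelling (R α : Type*) [CommRing R] : Type _ := Finset α →₀ R

namespace Labelling

open Classical

variable {R : Type*} [CommRing R] {α β : Type*}

/-- Multiplication by the label `x` at `a`; it is zero where `a` already has the label `x`. -/
def ins (R : Type*) [CommRing R] (a : α) : Labelling R α →ₗ[R] Labelling R α :=
  Finsupp.linearCombination R fun X => if a ∈ X then 0 else Finsupp.single (insert a X) 1

/-- Removal of the label `x` at `a`; it is zero where `a` has the label `1`. -/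
def del (R : Type*) [CommRing R] (a : α) : Labelling R α →ₗ[R] Labelling R α :=
  Finsupp.linearCombination R fun X => if a ∈ X then Finsupp.single (X.erase a) 1 else 0

/-- Multiplication of the labelling `c` by `(-1) ^ #{a | c a = x ∧ p a}`. -/
def sgn (R : Type*) [CommRing R] (p : α → Prop) : Labelling R α →ₗ[R] Labelling R α :=
  Finsupp.linearCombination R fun X => Finsupp.single X ((-1) ^ (X.filter p).card)

/-- Multiplication of the labels along the fibres of a map of sets, where `x * x = 0`. -/
def push (R : Type*) [CommRing R] (h : α → β) : Labelling R α →ₗ[R] Labelling R β :=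
  Finsupp.linearCombination R fun X =>
    if Set.InjOn h X then Finsupp.single (X.image h) 1 else 0

theorem ins_single (a : α) (X : Finset α) :
    ins R a (Finsupp.single X 1) = if a ∈ X then 0 else Finsupp.single (insert a X) 1 := by
  simp [ins]

theorem del_single (a : α) (X : Finset α) :
    del R a (Finsupp.single X 1) = if a ∈ X then Finsupp.single (X.erase a) 1 else 0 := by
  simp [del]

theorem sgn_single (p : α → Prop) (X : Finset α) :
    sgn R p (Finsupp.single X 1) = (-1 : R) ^ (X.filter p).card • Finsupp.single X 1 := by
  simp [sgn]

theorem push_single (h : α → β) (X : Finset α) : push R h (Finsupp.single X 1) =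
    if Set.InjOn h X then Finsupp.single (X.image h) 1 else 0 := by
  simp [push]

theorem hom_ext {M : Type*} [AddCommGroup M] [Module R M] {f g : (Labelling R α) →ₗ[R] M}
    (h : ∀ X, f (Finsupp.single X 1) = g (Finsupp.single X 1)) : f = g :=
  Finsupp.lhom_ext' fun X => LinearMap.ext_ring (h X)

theorem ins_del_add (a : α) (x : Labelling R α) :
    ins R a (del R a x) + del R a (ins R a x) = x := by
  refine LinearMap.congr_fun (f := ins R a ∘ₗ del R a + del R a ∘ₗ ins R a) (g := .id)
    (hom_ext fun X => ?_) x
  by_cases h : a ∈ X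
  · simp [ins_single, del_single, h]
  · simp [ins_single, del_single, h]

theorem ins_ins (a : α) (x : Labelling R α) : ins R a (ins R a x) = 0 := by
  refine LinearMap.congr_fun (f := ins R a ∘ₗ ins R a) (g := 0) (hom_ext fun X => ?_) x
  by_cases h : a ∈ X
  · simp [ins_single, h]
  · simp [ins_single, h]

theorem ins_comm (a b : α) (x : Labelling R α) : ins R a (ins R b x) = ins R b (ins R a x) := by
  refine LinearMap.congr_fun (f := ins R a ∘ₗ ins R b) (g := ins R b ∘ₗ ins R a)
    (hom_ext fun X => ?_) x
  rcases eq_or_ne a b with rfl | hab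
  · rfl
  by_cases ha : a ∈ X <;> by_cases hb : b ∈ X <;>
    simp [ins_single, ha, hb, hab, hab.symm, Finset.insert_comm]

theorem del_ins_of_ne {a b : α} (hab : a ≠ b) (x : Labelling R α) :
    del R a (ins R b x) = ins R b (del R a x) := by
  refine LinearMap.congr_fun (f := del R a ∘ₗ ins R b) (g := ins R b ∘ₗ del R a)
    (hom_ext fun X => ?_) x
  by_cases ha : a ∈ X <;> by_cases hb : b ∈ X
  · simp [ins_single, del_single, ha, hb, hab.symm]
  · simp [ins_single, del_single, ha, hb, Finset.erase_insert_of_ne hab.symm]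
  · simp [ins_single, del_single, ha, hb]
  · simp [ins_single, del_single, ha, hb, hab]

theorem sgn_sgn (p : α → Prop) (x : Labelling R α) : sgn R p (sgn R p x) = x := by
  refine LinearMap.congr_fun (f := sgn R p ∘ₗ sgn R p) (g := .id) (hom_ext fun X => ?_) x
  rw [LinearMap.comp_apply, sgn_single, map_smul, sgn_single, smul_smul, ← pow_add,
    Even.neg_one_pow (Even.add_self _), one_smul, LinearMap.id_apply]

theorem sgn_ins_of_pos {p : α → Prop} {a : α} (ha : p a) (x : Labelling R α) :
    sgn R p (ins R a x) = - ins R a (sgn R p x) := by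
  refine LinearMap.congr_fun (f := sgn R p ∘ₗ ins R a) (g := - (ins R a ∘ₗ sgn R p))
    (hom_ext fun X => ?_) x
  simp only [LinearMap.comp_apply, LinearMap.neg_apply, sgn_single, map_smul, ins_single]
  split_ifs with h
  · simp
  · rw [sgn_single, Finset.filter_insert, if_pos ha, Finset.card_insert_of_notMem (by simp [h]),
      pow_succ]
    simp

theorem sgn_ins_of_neg {p : α → Prop} {a : α} (ha : ¬ p a) (x : Labelling R α) :
    sgn R p (ins R a x) = ins R a (sgn R p x) := by
  refine LinearMap.congr_fun (f := sgn R p ∘ₗ ins R a) (g := ins R a ∘ₗ sgn R p)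
    (hom_ext fun X => ?_) x
  simp only [LinearMap.comp_apply, sgn_single, map_smul, ins_single]
  split_ifs with h
  · simp
  · rw [sgn_single, Finset.filter_insert, if_neg ha]

theorem sgn_del_of_pos {p : α → Prop} {a : α} (ha : p a) (x : Labelling R α) :
    sgn R p (del R a x) = - del R a (sgn R p x) := by
  refine LinearMap.congr_fun (f := sgn R p ∘ₗ del R a) (g := - (del R a ∘ₗ sgn R p))
    (hom_ext fun X => ?_) x
  simp only [LinearMap.comp_apply, LinearMap.neg_apply, sgn_single, map_smul, del_single]
  split_ifs with h
  · have hX : (X.filter p).card = ((X.erase a).filter p).card + 1 := by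
      rw [Finset.filter_erase, Finset.card_erase_add_one (Finset.mem_filter.2 ⟨h, ha⟩)]
    rw [sgn_single, hX, pow_succ]
    simp
  · simp

theorem push_ins (h : α → β) (a : α) (x : Labelling R α) :
    push R h (ins R a x) = ins R (h a) (push R h x) := by
  refine LinearMap.congr_fun (f := push R h ∘ₗ ins R a) (g := ins R (h a) ∘ₗ push R h)
    (hom_ext fun X => ?_) x
  simp only [LinearMap.comp_apply, push_single, ins_single]
  by_cases ha : a ∈ X
  · rw [if_pos ha, map_zero]
    split_ifs
    · rw [ins_single, if_pos (Finset.mem_image_of_mem h ha)]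
    · rw [map_zero]
  · have hins : Set.InjOn h (insert a X : Finset α) ↔ Set.InjOn h X ∧ h a ∉ X.image h := by
      rw [Finset.coe_insert, Set.injOn_insert (by simpa using ha)]
      simp
    rw [if_neg ha, push_single]
    by_cases h1 : Set.InjOn h X
    · by_cases h2 : h a ∈ X.image h
      · rw [if_neg fun h' => (hins.1 h').2 h2, if_pos h1, ins_single, if_pos h2]
      · rw [if_pos (hins.2 ⟨h1, h2⟩), if_pos h1, ins_single, if_neg h2, Finset.image_insert]
    · rw [if_neg fun h' => h1 (hins.1 h').1, if_neg h1, map_zero]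

theorem push_sgn (h : α → β) {p : α → Prop} {q : β → Prop} (hpq : ∀ a, q (h a) ↔ p a)
    (x : Labelling R α) : push R h (sgn R p x) = sgn R q (push R h x) := by
  refine LinearMap.congr_fun (f := push R h ∘ₗ sgn R p) (g := sgn R q ∘ₗ push R h)
    (hom_ext fun X => ?_) x
  simp only [LinearMap.comp_apply, push_single, sgn_single, map_smul]
  split_ifs with hX
  · have : (X.image h).filter q = (X.filter p).image h := by
      ext b
      simp only [Finset.mem_filter, Finset.mem_image]
      constructor
      · rintro ⟨⟨a, ha, rfl⟩, hb⟩
        exact ⟨a, ⟨ha, (hpq a).1 hb⟩, rfl⟩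
      · rintro ⟨a, ⟨ha, hp⟩, rfl⟩
        exact ⟨⟨a, ha, rfl⟩, (hpq a).2 hp⟩
    rw [sgn_single, this, Finset.card_image_of_injOn
      (hX.mono (Finset.coe_subset.2 (Finset.filter_subset p X)))]
  · simp

theorem push_push {γ : Type*} (h : α → β) (h' : β → γ) (x : Labelling R α) :
    push R h' (push R h x) = push R (h' ∘ h) x := by
  refine LinearMap.congr_fun (f := push R h' ∘ₗ push R h) (g := push R (h' ∘ h))
    (hom_ext fun X => ?_) x
  simp only [LinearMap.comp_apply, push_single]
  by_cases h1 : Set.InjOn h X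
  · have h2 : Set.InjOn h' (X.image h : Finset β) ↔ Set.InjOn (h' ∘ h) X := by
      rw [Finset.coe_image]
      exact ⟨fun h2 => (Set.InjOn.comp_iff h1).2 h2, fun h2 => (Set.InjOn.comp_iff h1).1 h2⟩
    simp only [if_pos h1, push_single, h2, Finset.image_image]
  · rw [if_neg h1, map_zero, if_neg fun h2 => h1 (Set.InjOn.of_comp h2)]

theorem push_single_of_eqOn_id {h : α → α} {X : Finset α} (hX : Set.EqOn h id X) :
    push R h (Finsupp.single X 1) = Finsupp.single X 1 := by
  rw [push_single, if_pos ((Set.injOn_id _).congr hX.symm), Finset.image_congr hX, Finset.image_id]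

theorem push_id (x : Labelling R α) : push R id x = x :=
  LinearMap.congr_fun (g := .id) (hom_ext fun _ => push_single_of_eqOn_id fun _ _ => rfl) x

theorem push_push_of_leftInverse {h : α → β} {h' : β → α} (hh : Function.LeftInverse h' h)
    (x : Labelling R α) : push R h' (push R h x) = x := by
  rw [push_push, hh.comp_eq_id, push_id]

theorem push_injective [Nonempty α] {h : α → β} (hh : Function.Injective h) :
    Function.Injective (push R h) :=
  Function.LeftInverse.injective
    (push_push_of_leftInverse (Function.leftInverse_invFun hh))

theorem push_update (u v : α) (x : Labelling R α) : push R (Function.update id v u) x =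
    x - (ins R v (del R v x) - ins R u (del R v x)) := by
  refine LinearMap.congr_fun (f := push R (Function.update id v u))
    (g := .id - (ins R v ∘ₗ del R v - ins R u ∘ₗ del R v)) (hom_ext fun X => ?_) x
  have hfix {Y : Finset α} (hY : v ∉ Y) : push R (Function.update id v u) (Finsupp.single Y 1) =
      Finsupp.single Y 1 :=
    push_single_of_eqOn_id fun a ha => Function.update_of_ne (ne_of_mem_of_not_mem ha hY) _ _
  by_cases hv : v ∈ X
  · have hX : ins R v (Finsupp.single (X.erase v) 1) = Finsupp.single X 1 := by
      rw [ins_single, if_neg (Finset.notMem_erase v X), Finset.insert_erase hv]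
    have hpush : push R (Function.update id v u) (Finsupp.single X 1) =
        ins R u (Finsupp.single (X.erase v) 1) := by
      rw [← hX, push_ins, hfix (Finset.notMem_erase v X), Function.update_self]
    simp [hpush, del_single, hv, hX]
  · simp [hfix hv, del_single, hv]

/-- The Koszul differential attached to merging `u` and `v`: multiplication by the difference of the
labels at `v` and `u`. Without the sign, which counts the labels `x` on the side `p` of `v`, it
would not square to zero, because `ins R u` and `ins R v` commute. -/
def koszul (R : Type*) [CommRing R] (p : α → Prop) (u v : α) : Labelling R α →ₗ[R] Labelling R α :=
  (ins R v - ins R u) ∘ₗ sgn R p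

/-- A contracting homotopy of `Labelling.koszul`. -/
def koszulContract (R : Type*) [CommRing R] (p : α → Prop) (v : α) :
    Labelling R α →ₗ[R] Labelling R α :=
  sgn R p ∘ₗ del R v

section Koszul

variable {p : α → Prop} {u v : α} {a : α} {j : ℤ} {x : Labelling R α}

theorem koszul_apply (x : Labelling R α) :
    koszul R p u v x = ins R v (sgn R p x) - ins R u (sgn R p x) := rfl

theorem koszul_koszulContract (x : Labelling R α) : koszul R p u v (koszulContract R p v x) =
    ins R v (del R v x) - ins R u (del R v x) := by
  rw [koszul_apply, koszulContract, LinearMap.comp_apply, sgn_sgn]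

theorem koszulContract_koszul (hu : ¬ p u) (hv : p v) (x : Labelling R α) :
    koszulContract R p v (koszul R p u v x) = del R v (ins R v x) + ins R u (del R v x) := by
  have huv : v ≠ u := fun h => hu (h ▸ hv)
  rw [koszul_apply, koszulContract, LinearMap.comp_apply, map_sub, map_sub, del_ins_of_ne huv,
    sgn_ins_of_neg hu, sgn_del_of_pos hv, sgn_del_of_pos hv, sgn_ins_of_pos hv, sgn_sgn, map_neg,
    map_neg, neg_neg, sub_neg_eq_add]

theorem koszul_koszulContract_add (hu : ¬ p u) (hv : p v) (x : Labelling R α) :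
    koszul R p u v (koszulContract R p v x) + koszulContract R p v (koszul R p u v x) = x := by
  rw [koszul_koszulContract, koszulContract_koszul hu hv, sub_add_add_cancel, ins_del_add]

theorem koszul_koszul (hu : ¬ p u) (hv : p v) (x : Labelling R α) :
    koszul R p u v (koszul R p u v x) = 0 := by
  rw [koszul_apply, koszul_apply, map_sub, sgn_ins_of_pos hv, sgn_ins_of_neg hu, sgn_sgn, map_sub,
    map_sub, map_neg, map_neg, ins_ins, ins_ins, ins_comm u v]
  abel

theorem push_koszul {h : α → β} {q : β → Prop} (hpq : ∀ a, q (h a) ↔ p a) (x : Labelling R α) :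
    push R h (koszul R p u v x) = koszul R q (h u) (h v) (push R h x) := by
  rw [koszul_apply, koszul_apply, map_sub, push_ins, push_ins, push_sgn h hpq]

theorem push_eq_zero_of_koszul_eq_zero (hu : ¬ p u) (hv : p v) {h : α → β} (huv : h u = h v)
    (hx : koszul R p u v x = 0) : push R h x = 0 := by
  rw [← koszul_koszulContract_add hu hv x, hx, map_zero, add_zero, koszul_koszulContract, map_sub,
    push_ins, push_ins, huv, sub_self]

theorem koszul_koszulContract_of_push_eq_zero {h : α → β} {t : β → α}
    (ht : t ∘ h = Function.update id v u) (hx : push R h x = 0) :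
    koszul R p u v (koszulContract R p v x) = x := by
  rw [koszul_koszulContract, ← sub_eq_zero, ← neg_eq_zero, neg_sub,
    ← push_update, ← ht, ← push_push,
    hx, map_zero]

/-- The span of the labellings with `j + 1` labels `x`, one of them at the root `a`. -/
def rootedDegree (R : Type*) [CommRing R] (a : α) (j : ℤ) : Submodule R (Labelling R α) :=
  Finsupp.supported R R {X | a ∈ X ∧ (X.card : ℤ) = j + 1}

theorem map_mem_supported {f : Labelling R α →ₗ[R] Labelling R β} {s : Set (Finset α)}
    {t : Set (Finset β)} (h : ∀ X ∈ s, f (Finsupp.single X 1) ∈ Finsupp.supported R R t)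
    {x : Labelling R α} (hx : x ∈ Finsupp.supported R R s) : f x ∈ Finsupp.supported R R t := by
  rw [Finsupp.supported_eq_span_single] at hx
  refine Submodule.span_le (p := (Finsupp.supported R R t).comap f).2 ?_ hx
  rintro _ ⟨X, hX, rfl⟩
  exact h X hX

theorem push_mem_rootedDegree (h : α → β) (hx : x ∈ rootedDegree R a j) :
    push R h x ∈ rootedDegree R (h a) j := by
  refine map_mem_supported (fun X hX => ?_) hx
  rw [push_single]
  split_ifs with hinj
  · exact Finsupp.single_mem_supported R _
      ⟨Finset.mem_image_of_mem h hX.1, by rw [Finset.card_image_of_injOn hinj, hX.2]⟩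
  · exact zero_mem _

theorem exists_push_eq {h : α → β} (hh : Function.Surjective h) {y : Labelling R β}
    (hy : y ∈ rootedDegree R (h a) j) : ∃ x ∈ rootedDegree R a j, push R h x = y := by
  let s := Function.update (Function.surjInv hh) (h a) a
  have hs : Function.LeftInverse h s := fun b => by
    rcases eq_or_ne b (h a) with rfl | hb
    · exact congrArg h (Function.update_self ..)
    · exact (congrArg h (Function.update_of_ne hb ..)).trans (Function.surjInv_eq hh b)
  refine ⟨push R s y, ?_, push_push_of_leftInverse hs y⟩
  rw [← (Function.update_self .. : s (h a) = a)]
  exact push_mem_rootedDegree s hy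

theorem ins_mem_rootedDegree (b : α) (hx : x ∈ rootedDegree R a j) :
    ins R b x ∈ rootedDegree R a (j + 1) := by
  refine map_mem_supported (fun X hX => ?_) hx
  rw [ins_single]
  split_ifs with hb
  · exact zero_mem _
  · refine Finsupp.single_mem_supported R _ ⟨Finset.mem_insert_of_mem hX.1, ?_⟩
    rw [Finset.card_insert_of_notMem hb, Nat.cast_succ, hX.2]

theorem del_mem_rootedDegree {b : α} (hab : a ≠ b) (hx : x ∈ rootedDegree R a j) :
    del R b x ∈ rootedDegree R a (j - 1) := by
  refine map_mem_supported (fun X hX => ?_) hx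
  rw [del_single]
  split_ifs with hb
  · refine Finsupp.single_mem_supported R _ ⟨Finset.mem_erase.2 ⟨hab, hX.1⟩, ?_⟩
    rw [Finset.cast_card_erase_of_mem hb, hX.2, sub_add_cancel, add_sub_cancel_right]
  · exact zero_mem _

theorem sgn_mem_rootedDegree (hx : x ∈ rootedDegree R a j) : sgn R p x ∈ rootedDegree R a j := by
  refine map_mem_supported (fun X hX => ?_) hx
  rw [sgn_single]
  exact Submodule.smul_mem _ _ (Finsupp.single_mem_supported R _ hX)

theorem koszul_mem_rootedDegree (hx : x ∈ rootedDegree R a j) :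
    koszul R p u v x ∈ rootedDegree R a (j + 1) :=
  sub_mem (ins_mem_rootedDegree v (sgn_mem_rootedDegree hx))
    (ins_mem_rootedDegree u (sgn_mem_rootedDegree hx))

theorem koszulContract_mem_rootedDegree (hav : a ≠ v) (hx : x ∈ rootedDegree R a j) :
    koszulContract R p v x ∈ rootedDegree R a (j - 1) :=
  sgn_mem_rootedDegree (del_mem_rootedDegree hav hx)

theorem eq_zero_of_mem_rootedDegree [Subsingleton α] (hj : j ≠ 0) (hx : x ∈ rootedDegree R a j) :
    x = 0 := by
  refine Finsupp.support_eq_empty.1 (Finset.eq_empty_of_forall_notMem fun X hX => hj ?_)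
  obtain ⟨ha, hcard⟩ := hx hX
  rw [Finset.eq_singleton_iff_unique_mem.2 ⟨ha, fun b _ => Subsingleton.elim b a⟩,
    Finset.card_singleton, Nat.cast_one] at hcard
  exact left_eq_add.1 (hcard.trans (add_comm j 1))

end Koszul

variable {a : α}

theorem ins_del_of_ins_eq_zero {x : Labelling R α} (hx : ins R a x = 0) :
    ins R a (del R a x) = x := by
  simpa [hx] using ins_del_add a x

theorem ker_ins (a : α) : LinearMap.ker (ins R a) = Finsupp.supported R R {X | a ∈ X} := by
  refine le_antisymm (fun x hx => ?_) ?_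
  · rw [← ins_del_of_ins_eq_zero hx]
    refine map_mem_supported (s := Set.univ) (fun X _ => ?_) (Finsupp.supported_univ.ge trivial)
    rw [ins_single]
    split_ifs with ha
    · exact zero_mem _
    · exact Finsupp.single_mem_supported R _ (Finset.mem_insert_self a X)
  · rw [Finsupp.supported_eq_span_single, Submodule.span_le]
    rintro _ ⟨X, hX, rfl⟩
    exact (ins_single a X).trans (if_pos hX)

theorem supported_inf_ker_ins (a : α) (j : ℤ) :
    Finsupp.supported R R {X : Finset α | (X.card : ℤ) = j} ⊓ LinearMap.ker (ins R a) =
      rootedDegree R a (j - 1) := by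
  rw [ker_ins, ← Finsupp.supported_inter, rootedDegree]
  congr 1
  ext X
  simp [and_comm]

theorem map_ins_supported (a : α) (j : ℤ) :
    (Finsupp.supported R R {X : Finset α | (X.card : ℤ) = j}).map (ins R a) =
      rootedDegree R a j := by
  refine le_antisymm (Submodule.map_le_iff_le_comap.2 fun x hx => ?_) fun y hy => ?_
  · refine map_mem_supported (fun X hX => ?_) hx
    rw [ins_single]
    split_ifs with ha
    · exact zero_mem _
    · refine Finsupp.single_mem_supported R _ ⟨Finset.mem_insert_self a X, ?_⟩
      rw [Finset.card_insert_of_notMem ha, Nat.cast_succ, hX]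
  · refine ⟨del R a y, map_mem_supported (fun X hX => ?_) hy, ins_del_of_ins_eq_zero ?_⟩
    · rw [del_single, if_pos hX.1]
      refine Finsupp.single_mem_supported R _ ?_
      rw [Set.mem_ofPred_eq, Finset.cast_card_erase_of_mem hX.1, hX.2, add_sub_cancel_right]
    · exact (ker_ins a).ge (Finsupp.supported_mono (fun X hX => hX.1) hy)

end Labelling

/-! ### The rooted chromatic complex -/

namespace ChromaticHomology

open Graph Labelling

variable {α β : Type*} {G : Graph α β}

section Components

variable {S T B : Set E(G)} {e : E(G)} {u v w : V(G)}

theorem mk_eq_mk_of_isLink (he : e ∈ S) (hl : G.IsLink e u v) :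
    (G.spanning S).connectedComponentMk u = (G.spanning S).connectedComponentMk v := by
  by_cases h : u = v
  · rw [h]
  · exact SimpleGraph.ConnectedComponent.sound
      (SimpleGraph.Adj.reachable (G := G.spanning S) ⟨h, e, he, hl⟩)

/-- The map on the components of `[G:S]` induced by a function which takes the same value at the
ends of every edge of `S`. -/
def connLift {X : Type*} (q : V(G) → X) (hq : ∀ e ∈ S, ∀ u v : V(G), G.IsLink e u v → q u = q v) :
    G.Conn S → X :=
  SimpleGraph.ConnectedComponent.lift q fun _ _ p hp => by
    clear hp
    induction p with
    | nil => rfl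
    | cons hadj _ ih =>
      obtain ⟨-, e, he, hl⟩ := hadj
      exact (hq e he _ _ hl).trans ih

theorem exists_section_connMap (hl : G.IsLink e u v) (hT : T = insert e S) (hST : S ⊆ T) :
    ∃ t : G.Conn T → G.Conn S, Function.RightInverse t (G.connMap hST) ∧
      open Classical in t ∘ G.connMap hST =
        Function.update id ((G.spanning S).connectedComponentMk v)
          ((G.spanning S).connectedComponentMk u) := by
  classical
  subst hT
  set c := (G.spanning S).connectedComponentMk
  have hupdate : Function.update id (c v) (c u) (c u) = Function.update id (c v) (c u) (c v) := by
    rw [Function.update_self, Function.update_apply, id, ite_id]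
  let t : G.Conn (insert e S) → G.Conn S :=
    connLift (fun w => Function.update id (c v) (c u) (c w)) fun f hf (w w' : V(G)) hl' => by
      rcases hf with rfl | hf
      · rcases hl'.eq_and_eq_or_eq_and_eq hl with ⟨h, h'⟩ | ⟨h, h'⟩
        · rw [Subtype.ext h, Subtype.ext h', hupdate]
        · rw [Subtype.ext h, Subtype.ext h', hupdate]
      · rw [show c w = c w' from mk_eq_mk_of_isLink hf hl']
  refine ⟨t, fun F => ?_, funext fun F => ?_⟩
  · induction F using SimpleGraph.ConnectedComponent.ind with | h w
    change G.connMap hST (Function.update id (c v) (c u) (c w)) = G.connMap hST (c w)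
    by_cases hw : c w = c v
    · rw [hw, Function.update_self]
      exact mk_eq_mk_of_isLink (Set.mem_insert e S) hl
    · rw [Function.update_of_ne hw, id]
  · induction F using SimpleGraph.ConnectedComponent.ind
    rfl

/-- The component `F` of `[G:S]` lies in the component of `v` in `[G:B]`; this is only meaningful
for `S ⊆ B`. -/
def LiesOver (B : Set E(G)) (v : V(G)) (F : G.Conn S) : Prop :=
  ∀ h : S ⊆ B, G.connMap h F = (G.spanning B).connectedComponentMk v

theorem liesOver_mk_iff (hS : S ⊆ B) :
    LiesOver B v ((G.spanning S).connectedComponentMk w) ↔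
      (G.spanning B).connectedComponentMk w = (G.spanning B).connectedComponentMk v :=
  ⟨fun h => h hS, fun h _ => h⟩

theorem liesOver_connMap_iff (hST : S ⊆ T) (hT : T ⊆ B) (F : G.Conn S) :
    LiesOver B v (G.connMap hST F) ↔ LiesOver B v F := by
  simp only [LiesOver, connMap_connMap]
  exact ⟨fun h _ => h hT, fun h _ => h (hST.trans hT)⟩

variable [Finite V(G)]

theorem connMap_injective_of_rank_eq (h : S ⊆ T) (hr : G.graphicRank S = G.graphicRank T) :
    Function.Injective (G.connMap h) := by
  refine ((Nat.bijective_iff_surjective_and_card _).2 ⟨G.connMap_surjective h, ?_⟩).1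
  have hS := G.card_conn_le S
  have hT := G.card_conn_le T
  unfold graphicRank at hr
  omega

variable [Finite E(G)]

theorem eRk_graphicMatroid (S : Set E(G)) : G.graphicMatroid.eRk S = G.graphicRank S :=
  matroidOfRank_rk ..

theorem connMap_injective_of_eRk_eq (h : S ⊆ T)
    (hr : G.graphicMatroid.eRk S = G.graphicMatroid.eRk T) : Function.Injective (G.connMap h) :=
  connMap_injective_of_rank_eq h <| by
    rwa [eRk_graphicMatroid, eRk_graphicMatroid, Nat.cast_inj] at hr

theorem mk_ne_mk_of_notMem_closure (he : e ∉ G.graphicMatroid.closure S) (hl : G.IsLink e u v) :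
    (G.spanning S).connectedComponentMk u ≠ (G.spanning S).connectedComponentMk v := by
  classical
  intro huv
  obtain ⟨t, -, ht⟩ := exists_section_connMap hl rfl (Set.subset_insert e S)
  rw [huv] at ht
  replace ht := ht.trans (Function.update_eq_self _ id)
  have hcard : Nat.card (G.Conn S) ≤ Nat.card (G.Conn (insert e S)) :=
    Nat.card_le_card_of_injective _ (Function.LeftInverse.injective (congrFun ht))
  have hrank := G.graphicMatroid.eRk_insert_eq_add_one ⟨Set.mem_univ e, he⟩
  rw [eRk_graphicMatroid, eRk_graphicMatroid] at hrank
  have hrank : G.graphicRank (insert e S) = G.graphicRank S + 1 := mod_cast hrank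
  unfold graphicRank at hrank
  omega

end Components

section Rooted

variable (R : Type*) [CommRing R]

/-- The cube of the labellings in which the component of the root `v₀` has the label `x`; this
label is not counted in the degree. -/
def rootedCube (G : Graph α β) (v₀ : V(G)) : GradedCube R E(G) where
  obj S := Labelling R (G.Conn (S : Set E(G)))
  map h := push R (G.connMap (Finset.coe_subset.2 h))
  map_map h h' x := (push_push _ _ x).trans
    (by rw [show G.connMap _ ∘ G.connMap _ = _ from funext (G.connMap_connMap _ _)])
  deg j S := rootedDegree R ((G.spanning (S : Set E(G))).connectedComponentMk v₀) j
  map_mem _ _ _ hx := push_mem_rootedDegree _ hx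

variable {R} {v₀ : V(G)} [LinearOrder E(G)]

theorem isKoszul_rootedCube {B : Finset E(G)} {e : E(G)} {u v : V(G)} (hl : G.IsLink e u v)
    (huv : (G.spanning (B : Set E(G))).connectedComponentMk u ≠
      (G.spanning (B : Set E(G))).connectedComponentMk v)
    (hv₀ : (G.spanning (B : Set E(G))).connectedComponentMk v₀ ≠
      (G.spanning (B : Set E(G))).connectedComponentMk v) :
    (rootedCube R G v₀).IsKoszul (fun S => koszul R (LiesOver (S := S) B v)
      ((G.spanning (S : Set E(G))).connectedComponentMk u)
      ((G.spanning (S : Set E(G))).connectedComponentMk v)) B e := by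
  have hu {S : Finset E(G)} (hS : S ⊆ B) := (liesOver_mk_iff (Finset.coe_subset.2 hS)).not.2 huv
  have hv {S : Finset E(G)} (hS : S ⊆ B) :=
    (liesOver_mk_iff (v := v) (w := v) (Finset.coe_subset.2 hS)).2 rfl
  have hroot {S : Finset E(G)} (hS : S ⊆ B) : (G.spanning (S : Set E(G))).connectedComponentMk v₀ ≠
      (G.spanning (S : Set E(G))).connectedComponentMk v :=
    fun h => hv₀ (congrArg (G.connMap (Finset.coe_subset.2 hS)) h)
  exact {
    mem _ _ _ hx := koszul_mem_rootedDegree hx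
    map {S T} h hT x := by
      have hmap := push_koszul (u := (G.spanning (S : Set E(G))).connectedComponentMk u)
        (v := (G.spanning (S : Set E(G))).connectedComponentMk v) (liesOver_connMap_iff
          (v := v) (Finset.coe_subset.2 h) (Finset.coe_subset.2 hT)) x
      rw [connMap_mk, connMap_mk] at hmap
      exact hmap.symm
    sq_eq_zero hS x := koszul_koszul (hu hS) (hv hS) x
    map_eq_zero {S} hS _ _ _ hx := push_eq_zero_of_koszul_eq_zero (hu hS) (hv hS)
      (mk_eq_mk_of_isLink (Finset.mem_coe.2 (Finset.mem_insert_self e S)) hl) hx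
    exact {S} hS _ x hx hmap := by
      obtain ⟨t, -, ht⟩ := exists_section_connMap hl (Finset.coe_insert e S)
        (Finset.coe_subset.2 (Finset.subset_insert e S))
      exact ⟨_, koszulContract_mem_rootedDegree (hroot hS) hx,
        koszul_koszulContract_of_push_eq_zero ht hmap⟩ }

theorem isMatroidal_rootedCube [Finite V(G)] [Finite E(G)] (hG : G.IsConn) :
    (rootedCube R G v₀).IsMatroidal G.graphicMatroid where
  ground_eq := rfl
  eq_zero {S} hS _ _ hj hx := by
    have hinj := connMap_injective_of_eRk_eq (Set.subset_univ (S : Set E(G)))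
      (hS.eRk_eq.trans G.graphicMatroid.eRk_ground.symm)
    have := hG.preconnected.subsingleton_connectedComponent
    have := hinj.subsingleton
    exact eq_zero_of_mem_rootedDegree hj hx
  exists_map_eq S e _ _ hy := exists_push_eq (G.connMap_surjective _) hy
  map_injective {S e} he := by
    have : Nonempty (G.Conn (S : Set E(G))) := ⟨(G.spanning _).connectedComponentMk v₀⟩
    refine push_injective (connMap_injective_of_eRk_eq _ ?_)
    rw [Finset.coe_insert, ← G.graphicMatroid.eRk_closure_eq,
      ← G.graphicMatroid.eRk_closure_eq (insert e _),
      G.graphicMatroid.closure_insert_eq_of_mem_closure he]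
  exists_isKoszul {S e} he := by
    obtain ⟨a, b, hab⟩ := G.exists_isLink_of_mem_edgeSet e.2
    obtain ⟨u, v, hl, hv₀⟩ : ∃ u v : V(G), G.IsLink e u v ∧
        (G.spanning (S : Set E(G))).connectedComponentMk v₀ ≠
          (G.spanning (S : Set E(G))).connectedComponentMk v := by
      by_cases h : (G.spanning (S : Set E(G))).connectedComponentMk v₀ =
          (G.spanning (S : Set E(G))).connectedComponentMk ⟨b, hab.right_mem⟩
      · exact ⟨⟨b, hab.right_mem⟩, ⟨a, hab.left_mem⟩, hab.symm,
          fun h' => mk_ne_mk_of_notMem_closure he hab.symm (h.symm.trans h')⟩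
      · exact ⟨⟨a, hab.left_mem⟩, ⟨b, hab.right_mem⟩, hab, h⟩
    exact ⟨_, isKoszul_rootedCube hl (mk_ne_mk_of_notMem_closure he hl) hv₀⟩

end Rooted

section Matroid

open Classical

theorem exists_rhoTilde_eq_span (G : Graph α β) :
    ∃ m : E(G) → V(G) →₀ ℤ, ∀ S, G.rhoTilde S = Submodule.span ℤ (m '' S) := by
  choose a b hab using fun e : E(G) => G.exists_isLink_of_mem_edgeSet e.2
  refine ⟨fun e => Finsupp.single ⟨a e, (hab e).left_mem⟩ 1 -
    Finsupp.single ⟨b e, (hab e).right_mem⟩ 1, fun S => le_antisymm (Submodule.span_le.2 ?_)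
    (Submodule.span_mono ?_)⟩
  · rintro _ ⟨e, he, v, v', hl, rfl⟩
    have hm := Submodule.subset_span (R := ℤ) (Set.mem_image_of_mem (fun e => Finsupp.single
      (⟨a e, (hab e).left_mem⟩ : V(G)) (1 : ℤ) - Finsupp.single ⟨b e, (hab e).right_mem⟩ 1) he)
    obtain ⟨rfl, rfl⟩ | ⟨rfl, rfl⟩ : v = ⟨a e, (hab e).left_mem⟩ ∧ v' = ⟨b e, (hab e).right_mem⟩ ∨
        v = ⟨b e, (hab e).right_mem⟩ ∧ v' = ⟨a e, (hab e).left_mem⟩ := by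
      simpa only [Subtype.ext_iff] using hl.eq_and_eq_or_eq_and_eq (hab e)
    · exact hm
    · exact neg_sub (Finsupp.single _ (1 : ℤ)) (Finsupp.single _ 1) ▸ neg_mem hm
  · rintro _ ⟨e, he, rfl⟩
    exact ⟨e, he, _, _, hab e, rfl⟩

variable [LinearOrder V(G)] {v₀ : V(G)} {S : Set E(G)}

theorem isMinVertex_of_isBot (hv₀ : IsBot v₀) (S : Set E(G)) : G.IsMinVertex S v₀ :=
  fun w _ => hv₀ w

theorem eq_of_mk_eq_mk {v w : V(G)} (hv : G.IsMinVertex S v) (hw : G.IsMinVertex S w)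
    (h : (G.spanning S).connectedComponentMk v = (G.spanning S).connectedComponentMk w) : v = w :=
  have hr := SimpleGraph.ConnectedComponent.exact h
  le_antisymm (hv w hr) (hw v hr.symm)

theorem minSubmodule_eq_span (hG : G.IsConn) (hv₀ : IsBot v₀) :
    G.minSubmodule = Submodule.span ℤ {Finsupp.single v₀ 1} := by
  have hmin : {v | G.IsMinVertex Set.univ v} = {v₀} :=
    Set.eq_singleton_iff_unique_mem.2 ⟨isMinVertex_of_isBot hv₀ _, fun v hv =>
      eq_of_mk_eq_mk hv (isMinVertex_of_isBot hv₀ _)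
        (SimpleGraph.ConnectedComponent.sound (hG.preconnected v v₀))⟩
  rw [minSubmodule, hmin, Set.image_singleton]

/-- The minimal vertices of the components of `[G:S]` which do not contain `v₀`. -/
abbrev MinIndex (v₀ : V(G)) (S : Set E(G)) : Type _ := {v : V(G) // G.IsMinVertex S v ∧ v ≠ v₀}

/-- The component of `[G:S]` with a given minimal vertex. -/
def component (v₀ : V(G)) (S : Set E(G)) : MinIndex v₀ S ↪ G.Conn S where
  toFun v := (G.spanning S).connectedComponentMk v
  inj' v w h := Subtype.ext (eq_of_mk_eq_mk v.2.1 w.2.1 h)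

theorem component_ne_root (hv₀ : IsBot v₀) (v : MinIndex v₀ S) :
    component v₀ S v ≠ (G.spanning S).connectedComponentMk v₀ :=
  fun h => v.2.2 (eq_of_mk_eq_mk v.2.1 (isMinVertex_of_isBot hv₀ S) h)

variable [Finite V(G)]

theorem exists_isMinVertex_mk_eq (S : Set E(G)) (v : V(G)) :
    ∃ w, G.IsMinVertex S w ∧
      (G.spanning S).connectedComponentMk v = (G.spanning S).connectedComponentMk w := by
  obtain ⟨w, hw, hmin⟩ := Set.exists_min_image {w | (G.spanning S).Reachable v w} id
    (Set.toFinite _) ⟨v, SimpleGraph.Reachable.refl v⟩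
  exact ⟨w, fun u hu => hmin u (SimpleGraph.Reachable.trans hw hu),
    SimpleGraph.ConnectedComponent.sound hw⟩

theorem exists_map_component_eq {X : Finset (G.Conn S)}
    (hX : (G.spanning S).connectedComponentMk v₀ ∉ X) :
    ∃ Y : Finset (MinIndex v₀ S), Y.map (component v₀ S) = X := by
  have hsub : (X : Set (G.Conn S)) ⊆ component v₀ S '' Set.univ := fun F hF => by
    induction F using SimpleGraph.ConnectedComponent.ind with | h v
    obtain ⟨w, hw, hvw⟩ := exists_isMinVertex_mk_eq S v
    exact ⟨⟨w, hw, fun h => hX (h ▸ hvw ▸ hF)⟩, trivial, hvw.symm⟩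
  obtain ⟨Y, -, hY⟩ := Finset.subset_set_image_iff.1 hsub
  exact ⟨Y, (Finset.map_eq_image _ Y).trans hY⟩

variable [Finite E(G)]

/-- The class of the vertex `v` in `N / ρ(S)`. -/
def vertexClass (S : Set E(G)) (v : V(G)) : ((V(G) →₀ ℤ) ⧸ G.minSubmodule) ⧸ G.canonical.ρ S :=
  (G.canonical.ρ S).mkQ (G.minSubmodule.mkQ (Finsupp.single v 1))

theorem vertexClass_eq_of_mk_eq_mk {v w : V(G)}
    (h : (G.spanning S).connectedComponentMk v = (G.spanning S).connectedComponentMk w) :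
    vertexClass S v = vertexClass S w := by
  rw [vertexClass, vertexClass, ← sub_eq_zero, ← map_sub, ← map_sub, Submodule.mkQ_apply,
    Submodule.Quotient.mk_eq_zero]
  exact ⟨_, G.single_sub_mem_rhoTilde (SimpleGraph.ConnectedComponent.exact h), rfl⟩

theorem vertexClass_root (hG : G.IsConn) (hv₀ : IsBot v₀) (S : Set E(G)) :
    vertexClass S v₀ = 0 := by
  have hroot : G.minSubmodule.mkQ (Finsupp.single v₀ 1) = 0 := by
    rw [Submodule.mkQ_apply, Submodule.Quotient.mk_eq_zero, minSubmodule_eq_span hG hv₀]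
    exact Submodule.mem_span_singleton_self _
  rw [vertexClass, hroot, map_zero]

theorem span_vertexClass (S : Set E(G)) :
    Submodule.span ℤ (Set.range (vertexClass S)) = ⊤ := by
  have hrange : Set.range (vertexClass S) =
      ((G.canonical.ρ S).mkQ ∘ₗ G.minSubmodule.mkQ) '' Set.range fun v => Finsupp.single v 1 := by
    rw [← Set.range_comp]
    rfl
  rw [hrange, ← Submodule.map_span, ← Finsupp.coe_basisSingleOne, Module.Basis.span_eq,
    Submodule.map_top, LinearMap.range_eq_top]
  exact (Submodule.mkQ_surjective _).comp (Submodule.mkQ_surjective _)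

theorem exists_dual_vertexClass (hG : G.IsConn) (hv₀ : IsBot v₀) {F : G.Conn S}
    (hF : (G.spanning S).connectedComponentMk v₀ ≠ F) :
    ∃ φ : Module.Dual ℤ (((V(G) →₀ ℤ) ⧸ G.minSubmodule) ⧸ G.canonical.ρ S),
      ∀ v, φ (vertexClass S v) = if (G.spanning S).connectedComponentMk v = F then 1 else 0 := by
  let ψ : (V(G) →₀ ℤ) →ₗ[ℤ] ℤ := Finsupp.lapply F ∘ₗ G.toConn S
  have hψ v : ψ (Finsupp.single v 1) =
      if (G.spanning S).connectedComponentMk v = F then 1 else 0 := by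
    rw [LinearMap.comp_apply, toConn_single, Finsupp.lapply_apply, Finsupp.single_apply]
  have hmin : G.minSubmodule ≤ LinearMap.ker ψ := by
    rw [minSubmodule_eq_span hG hv₀, Submodule.span_singleton_le_iff_mem, LinearMap.mem_ker, hψ,
      if_neg hF]
  have hρ : G.canonical.ρ S ≤ LinearMap.ker (G.minSubmodule.liftQ ψ hmin) := by
    refine Submodule.map_le_iff_le_comap.2 ?_
    rw [← LinearMap.ker_comp, Submodule.liftQ_mkQ, ← ker_toConn]
    exact LinearMap.ker_le_ker_comp _ _
  exact ⟨(G.canonical.ρ S).liftQ _ hρ, hψ⟩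

theorem linearIndependent_vertexClass (hG : G.IsConn) (hv₀ : IsBot v₀) (S : Set E(G)) :
    LinearIndependent ℤ fun v : MinIndex v₀ S => vertexClass S v.1 := by
  choose φ hφ using fun v : MinIndex v₀ S =>
    exists_dual_vertexClass hG hv₀ (component_ne_root hv₀ v).symm
  refine .of_pairwise_dual_eq_zero_one _ φ (fun v w hvw => ?_) fun v => ?_
  · exact (hφ v w).trans (if_neg fun h => hvw ((component v₀ S).injective h).symm)
  · exact (hφ v v).trans (if_pos rfl)

theorem span_vertexClass_minIndex (hG : G.IsConn) (hv₀ : IsBot v₀) (S : Set E(G)) :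
    ⊤ ≤ Submodule.span ℤ (Set.range fun v : MinIndex v₀ S => vertexClass S v.1) := by
  rw [← span_vertexClass, Submodule.span_le]
  rintro _ ⟨v, rfl⟩
  obtain ⟨w, hw, hvw⟩ := exists_isMinVertex_mk_eq S v
  rw [vertexClass_eq_of_mk_eq_mk hvw]
  rcases eq_or_ne w v₀ with rfl | hw₀
  · rw [vertexClass_root hG hv₀]
    exact zero_mem _
  · exact Submodule.subset_span ⟨⟨w, hw, hw₀⟩, rfl⟩

/-- The basis of `N / ρ(S)` formed by the classes `v_{S,F}` of the minimal vertices of the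
components `F ≠ F₀` of `[G:S]`. -/
def minVertexBasis (hG : G.IsConn) (hv₀ : IsBot v₀) (S : Set E(G)) :
    Module.Basis (MinIndex v₀ S) ℤ (((V(G) →₀ ℤ) ⧸ G.minSubmodule) ⧸ G.canonical.ρ S) :=
  .mk (linearIndependent_vertexClass hG hv₀ S) (span_vertexClass_minIndex hG hv₀ S)

theorem isMatroidal_canonical [LinearOrder E(G)] (hG : G.IsConn) (hv₀ : IsBot v₀) :
    G.canonical.cube.IsMatroidal G.graphicMatroid := by
  have (S : Set E(G)) := Module.Free.of_basis (minVertexBasis hG hv₀ S)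
  obtain ⟨m, hm⟩ := exists_rhoTilde_eq_span G
  refine QuasiRepresentation.isMatroidal_cube (m := G.minSubmodule.mkQ ∘ m) fun S => ?_
  rw [Set.image_comp, ← Submodule.map_span, ← hm]
  rfl

theorem wedge_map_component (hG : G.IsConn) (hv₀ : IsBot v₀) (S : Set E(G))
    (Y : Finset (MinIndex v₀ S)) :
    G.wedge S (Y.map (component v₀ S)) = (minVertexBasis hG hv₀ S).ExteriorAlgebra Y := by
  have hset : (Set.toFinite {v | G.IsMinVertex S v ∧ (G.spanning S).connectedComponentMk v ∈
      Y.map (component v₀ S)}).toFinset = Y.map (.subtype _) := by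
    ext v
    simp only [Set.Finite.mem_toFinset, Set.mem_ofPred_eq, Finset.mem_map]
    constructor
    · rintro ⟨hv, w, hw, hwv⟩
      exact ⟨w, hw, eq_of_mk_eq_mk w.2.1 hv hwv⟩
    · rintro ⟨w, hw, rfl⟩
      exact ⟨w.2.1, w, hw, rfl⟩
  rw [wedge, hset, ← StrictMonoOn.map_finsetSort _ _ ((Subtype.strictMono_coe _).strictMonoOn _),
    List.map_map, basis_exteriorAlgebra_eq_prod_sort]
  refine congrArg List.prod (List.map_congr_left fun v _ => ?_)
  rw [minVertexBasis, Module.Basis.mk_apply]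
  rfl

theorem wedge_eq_zero (hG : G.IsConn) (hv₀ : IsBot v₀) {X : Finset (G.Conn S)}
    (hX : (G.spanning S).connectedComponentMk v₀ ∈ X) : G.wedge S X = 0 := by
  refine List.prod_eq_zero (List.mem_map.2 ⟨v₀, ?_, ?_⟩)
  · rw [Finset.mem_sort, Set.Finite.mem_toFinset]
    exact ⟨isMinVertex_of_isBot hv₀ S, hX⟩
  · exact (congrArg _ (vertexClass_root hG hv₀ S)).trans (map_zero _)

/-- The component `⨁ C^{i,j}(G) → ⨁ C^{i,j}(M(G))` of `θ` at a fixed edge set `S`. -/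
def thetaAt (S : Set E(G)) : Labelling ℤ (G.Conn S) →ₗ[ℤ]
    ExteriorAlgebra ℤ (((V(G) →₀ ℤ) ⧸ G.minSubmodule) ⧸ G.canonical.ρ S) :=
  Finsupp.linearCombination ℤ (G.wedge S)

theorem thetaAt_single (S : Set E(G)) (X : Finset (G.Conn S)) :
    thetaAt S (Finsupp.single X 1) = G.wedge S X :=
  (Finsupp.linearCombination_single ..).trans (one_smul ..)

/-- The component of `τ` at a fixed edge set `S`, defined on the basis of the exterior algebra
formed by the products `v_{S,X}` with `F₀ ∉ X`. -/
def tauAt (hG : G.IsConn) (hv₀ : IsBot v₀) (S : Set E(G)) :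
    ExteriorAlgebra ℤ (((V(G) →₀ ℤ) ⧸ G.minSubmodule) ⧸ G.canonical.ρ S) →ₗ[ℤ]
      Labelling ℤ (G.Conn S) :=
  (minVertexBasis hG hv₀ S).ExteriorAlgebra.constr ℤ fun Y =>
    ins ℤ ((G.spanning S).connectedComponentMk v₀) (Finsupp.single (Y.map (component v₀ S)) 1)

theorem tauAt_wedge (hG : G.IsConn) (hv₀ : IsBot v₀) (S : Set E(G)) (X : Finset (G.Conn S)) :
    tauAt hG hv₀ S (G.wedge S X) =
      ins ℤ ((G.spanning S).connectedComponentMk v₀) (Finsupp.single X 1) := by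
  by_cases hX : (G.spanning S).connectedComponentMk v₀ ∈ X
  · rw [wedge_eq_zero hG hv₀ hX, map_zero, ins_single, if_pos hX]
  · obtain ⟨Y, rfl⟩ := exists_map_component_eq hX
    rw [wedge_map_component hG hv₀, tauAt, Module.Basis.constr_basis]

theorem tauAt_thetaAt (hG : G.IsConn) (hv₀ : IsBot v₀) (S : Set E(G))
    (x : Labelling ℤ (G.Conn S)) :
    tauAt hG hv₀ S (thetaAt S x) = ins ℤ ((G.spanning S).connectedComponentMk v₀) x := by
  suffices h : tauAt hG hv₀ S ∘ₗ thetaAt S = ins ℤ ((G.spanning S).connectedComponentMk v₀) from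
    LinearMap.congr_fun h x
  refine hom_ext fun X => ?_
  rw [LinearMap.comp_apply, thetaAt_single, tauAt_wedge]

theorem map_thetaAt_supported (hG : G.IsConn) (hv₀ : IsBot v₀) (S : Set E(G)) (j : ℤ) :
    (Finsupp.supported ℤ ℤ {X : Finset (G.Conn S) | (X.card : ℤ) = j}).map (thetaAt S) =
      exteriorDegree ℤ (((V(G) →₀ ℤ) ⧸ G.minSubmodule) ⧸ G.canonical.ρ S) j := by
  rw [← span_basis_exteriorAlgebra (minVertexBasis hG hv₀ S), Finsupp.supported_eq_span_single,
    Submodule.map_span]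
  refine le_antisymm (Submodule.span_le.2 ?_) (Submodule.span_mono ?_)
  · rintro _ ⟨_, ⟨X, hX, rfl⟩, rfl⟩
    rw [thetaAt_single]
    by_cases hX₀ : (G.spanning S).connectedComponentMk v₀ ∈ X
    · rw [wedge_eq_zero hG hv₀ hX₀]
      exact zero_mem _
    · obtain ⟨Y, rfl⟩ := exists_map_component_eq hX₀
      rw [wedge_map_component hG hv₀]
      exact Submodule.subset_span ⟨Y, (congrArg _ (Finset.card_map _)).symm.trans hX, rfl⟩
  · rintro _ ⟨Y, hY, rfl⟩
    refine ⟨_, ⟨Y.map (component v₀ S), (congrArg _ (Finset.card_map _)).trans hY, rfl⟩, ?_⟩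
    rw [thetaAt_single, wedge_map_component hG hv₀]

theorem map_tauAt_exteriorDegree (hG : G.IsConn) (hv₀ : IsBot v₀) (S : Set E(G)) (j : ℤ) :
    (exteriorDegree ℤ (((V(G) →₀ ℤ) ⧸ G.minSubmodule) ⧸ G.canonical.ρ S) j).map (tauAt hG hv₀ S) =
      rootedDegree ℤ ((G.spanning S).connectedComponentMk v₀) j := by
  rw [← map_thetaAt_supported hG hv₀, ← map_ins_supported, ← Submodule.map_comp]
  congr 1
  exact LinearMap.ext (tauAt_thetaAt hG hv₀ S)

theorem surjective_thetaAt (hG : G.IsConn) (hv₀ : IsBot v₀) (S : Set E(G)) :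
    Function.Surjective (thetaAt S) := by
  rw [← LinearMap.range_eq_top, thetaAt, Finsupp.range_linearCombination, eq_top_iff,
    ← (minVertexBasis hG hv₀ S).ExteriorAlgebra.span_eq]
  refine Submodule.span_mono ?_
  rintro _ ⟨Y, rfl⟩
  exact ⟨_, wedge_map_component hG hv₀ S Y⟩

theorem thetaAt_ins (hG : G.IsConn) (hv₀ : IsBot v₀) (S : Set E(G))
    (x : Labelling ℤ (G.Conn S)) :
    thetaAt S (ins ℤ ((G.spanning S).connectedComponentMk v₀) x) = 0 := by
  suffices h : thetaAt S ∘ₗ ins ℤ ((G.spanning S).connectedComponentMk v₀) = 0 from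
    LinearMap.congr_fun h x
  refine hom_ext fun X => ?_
  rw [LinearMap.comp_apply, ins_single, LinearMap.zero_apply]
  split_ifs
  · exact map_zero _
  · rw [thetaAt_single, wedge_eq_zero hG hv₀ (Finset.mem_insert_self _ _)]

theorem ker_thetaAt (hG : G.IsConn) (hv₀ : IsBot v₀) (S : Set E(G)) :
    LinearMap.ker (thetaAt S) = LinearMap.ker (ins ℤ ((G.spanning S).connectedComponentMk v₀)) := by
  ext x
  constructor
  · intro hx
    rw [LinearMap.mem_ker, ← tauAt_thetaAt hG hv₀, LinearMap.mem_ker.1 hx, map_zero]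
  · intro hx
    rw [LinearMap.mem_ker, ← ins_del_of_ins_eq_zero hx, thetaAt_ins hG hv₀]

theorem injective_tauAt (hG : G.IsConn) (hv₀ : IsBot v₀) (S : Set E(G)) :
    Function.Injective (tauAt hG hv₀ S) := by
  refine (injective_iff_map_eq_zero _).2 fun y hy => ?_
  obtain ⟨x, rfl⟩ := surjective_thetaAt hG hv₀ S y
  rw [tauAt_thetaAt] at hy
  exact (ker_thetaAt hG hv₀ S).ge hy

theorem exact_tauAt_thetaAt (hG : G.IsConn) (hv₀ : IsBot v₀) (S : Set E(G)) :
    Function.Exact (tauAt hG hv₀ S) (thetaAt S) := by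
  intro x
  constructor
  · intro hx
    refine ⟨thetaAt S (del ℤ ((G.spanning S).connectedComponentMk v₀) x), ?_⟩
    rw [tauAt_thetaAt, ins_del_of_ins_eq_zero ((ker_thetaAt hG hv₀ S).le hx)]
  · rintro ⟨y, rfl⟩
    obtain ⟨x, rfl⟩ := surjective_thetaAt hG hv₀ S y
    rw [tauAt_thetaAt, thetaAt_ins hG hv₀]

/-- The map `τ`, assembled from its components at all edge sets. It preserves the number `i` of
edges and raises `j` by one. -/
def tau (hG : G.IsConn) (hv₀ : IsBot v₀) :
    (∀ S, G.canonical.cube.obj S) →ₗ[ℤ] (∀ S, G.chromaticCube.obj S) :=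
  LinearMap.piMap fun S : Finset E(G) => tauAt hG hv₀ (S : Set E(G))

theorem isTau_tau (hG : G.IsConn) (hv₀ : IsBot v₀) : G.IsTau v₀ (tau hG hv₀) := by
  intro S X
  refine (piMap_single (M := G.canonical.cube.obj) (N := G.chromaticCube.obj)
    (fun S => tauAt hG hv₀ (S : Set E(G))) S _).trans ?_
  refine (congrArg (Pi.single (M := G.chromaticCube.obj) S) (tauAt_wedge hG hv₀ S X)).trans ?_
  rw [ins_single]
  split_ifs
  · exact Pi.single_zero (M := G.chromaticCube.obj) S
  · rfl

theorem injective_tau (hG : G.IsConn) (hv₀ : IsBot v₀) : Function.Injective (tau hG hv₀) :=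
  Function.Injective.piMap fun S : Finset E(G) => injective_tauAt hG hv₀ (S : Set E(G))

theorem surjective_theta (hG : G.IsConn) (hv₀ : IsBot v₀) : Function.Surjective G.theta :=
  Function.Surjective.piMap fun S : Finset E(G) => surjective_thetaAt hG hv₀ (S : Set E(G))

theorem exact_tau_theta (hG : G.IsConn) (hv₀ : IsBot v₀) :
    Function.Exact (tau hG hv₀) G.theta := by
  intro x
  have hx (S : Finset E(G)) := exact_tauAt_thetaAt hG hv₀ S (x S)
  refine funext_iff.trans ((forall_congr' hx).trans ?_)
  exact ⟨fun h => ⟨fun S => (h S).choose, funext fun S => (h S).choose_spec⟩,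
    fun ⟨y, hy⟩ S => ⟨y S, congrFun hy S⟩⟩

theorem map_tau_chain (hG : G.IsConn) (hv₀ : IsBot v₀) (i j : ℤ) :
    (G.canonical.cube.chain i j).map (tau hG hv₀) = (rootedCube ℤ G v₀).chain i j :=
  GradedCube.map_piMap_chain (K' := rootedCube ℤ G v₀)
    (fun S => map_tauAt_exteriorDegree hG hv₀ (S : Set E(G)) j) i

theorem map_theta_chain (hG : G.IsConn) (hv₀ : IsBot v₀) (i j : ℤ) :
    (G.chromaticCube.chain i j).map G.theta = G.canonical.cube.chain i j :=
  GradedCube.map_piMap_chain (fun S => map_thetaAt_supported hG hv₀ (S : Set E(G)) j) i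

theorem nonempty_matroidComplex_iso [LinearOrder E(G)] (hG : G.IsConn) (hv₀ : IsBot v₀) (j : ℤ) :
    Nonempty (G.matroidComplex j ≅ (rootedCube ℤ G v₀).complex j) := by
  refine (isMatroidal_canonical hG hv₀).nonempty_complex_iso (isMatroidal_rootedCube hG)
    (fun S => ?_) (fun S => ?_) (fun S => ?_) (fun S => ?_) j fun i => ?_
  · exact .of_basis (minVertexBasis hG hv₀ S).ExteriorAlgebra
  · exact .of_basis (minVertexBasis hG hv₀ S).ExteriorAlgebra
  · exact inferInstanceAs (Module.Finite ℤ (Finset (G.Conn (S : Set E(G))) →₀ ℤ))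
  · exact inferInstanceAs (Module.Free ℤ (Finset (G.Conn (S : Set E(G))) →₀ ℤ))
  · rw [← map_tau_chain hG hv₀]
    exact (Submodule.equivMapOfInjective _ (injective_tau hG hv₀) _).finrank_eq

end Matroid

section LongExactSequence

variable {v₀ : V(G)}

theorem map_id_deg_rootedCube (j : ℤ) (S : Finset E(G)) :
    ((rootedCube ℤ G v₀).deg (j - 1) S).map LinearMap.id = G.chromaticCube.deg j S ⊓
      LinearMap.ker (ins ℤ ((G.spanning (S : Set E(G))).connectedComponentMk v₀)) :=
  (Submodule.map_id _).trans (supported_inf_ker_ins _ j).symm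

variable [LinearOrder E(G)]

/-- The inclusion of the enhanced states in which the component of `v₀` is labelled `x`. -/
def rootedInclusion (v₀ : V(G)) (j : ℤ) :
    (rootedCube ℤ G v₀).complex (j - 1) ⟶ G.chromaticComplex j :=
  GradedCube.complexMap (K := rootedCube ℤ G v₀) (K' := G.chromaticCube)
    (fun _ => LinearMap.id) (fun _ _ _ _ => rfl)
    fun S => (map_id_deg_rootedCube j S).trans_le inf_le_left

/-- Multiplication by the label `x` at the component of `v₀`. -/
def rootedProjection (v₀ : V(G)) (j : ℤ) :
    G.chromaticComplex j ⟶ (rootedCube ℤ G v₀).complex j :=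
  GradedCube.complexMap (K := G.chromaticCube) (K' := rootedCube ℤ G v₀)
    (fun S : Finset E(G) => ins ℤ ((G.spanning (S : Set E(G))).connectedComponentMk v₀))
    (fun S _ h x => (push_ins (G.connMap (Finset.coe_subset.2 h))
      ((G.spanning (S : Set E(G))).connectedComponentMk v₀) x).symm)
    fun _ => (map_ins_supported _ j).le

theorem rootedInclusion_comp_rootedProjection (v₀ : V(G)) (j : ℤ) :
    rootedInclusion v₀ j ≫ rootedProjection v₀ j = 0 :=
  GradedCube.complexMap_comp_eq_zero (map_id_deg_rootedCube j)

theorem shortExact_rooted (v₀ : V(G)) (j : ℤ) :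
    (ShortComplex.mk (rootedInclusion v₀ j) (rootedProjection v₀ j)
      (rootedInclusion_comp_rootedProjection v₀ j)).ShortExact :=
  GradedCube.shortExact_complexMap (fun _ => Function.injective_id) (map_id_deg_rootedCube j)
    fun _ => map_ins_supported _ j

theorem map_range_rootedInclusion (v₀ : V(G)) (i j : ℤ) :
    (LinearMap.range ((rootedInclusion v₀ j).f i).hom).map (G.chromaticCube.chain i j).subtype =
      (rootedCube ℤ G v₀).chain i (j - 1) :=
  (GradedCube.map_range_complexMap i).trans (Submodule.map_id _)

variable [LinearOrder V(G)] [Finite V(G)] [Finite E(G)]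

theorem map_ker_rootedProjection (hG : G.IsConn) (hv₀ : IsBot v₀) (i j : ℤ) :
    (LinearMap.ker ((rootedProjection v₀ j).f i).hom).map (G.chromaticCube.chain i j).subtype =
      G.chromaticCube.chain i j ⊓ LinearMap.ker G.theta := by
  refine (GradedCube.map_ker_complexMap i).trans (congrArg _ (Submodule.ext fun x => ?_))
  refine (funext_iff.trans (forall_congr' fun S : Finset E(G) => ?_)).trans funext_iff.symm
  exact (Submodule.ext_iff.1 (ker_thetaAt hG hv₀ (S : Set E(G))) (x S)).symm

end LongExactSequence

end ChromaticHomology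

end

open ChromaticHomology

theorem theorem6p5 {α β : Type*} (G : Graph α β) [Finite V(G)] [Finite E(G)] [LinearOrder V(G)]
    [LinearOrder E(G)] (hG : G.IsConn) (v₀ : V(G)) (hv₀ : IsBot v₀) :
    ∃ τ : (∀ S, G.canonical.cube.obj S) →ₗ[ℤ] (∀ S, G.chromaticCube.obj S),
      G.IsTau v₀ τ ∧
      Function.Injective τ ∧ Function.Exact τ G.theta ∧ Function.Surjective G.theta ∧
      (∀ i j : ℤ, (G.canonical.cube.chain i (j - 1)).map τ ≤ G.chromaticCube.chain i j ∧
        (G.chromaticCube.chain i j).map G.theta ≤ G.canonical.cube.chain i j) ∧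
      ∀ j : ℤ,
        ∃ (f : G.matroidComplex (j - 1) ⟶ G.chromaticComplex j)
          (g : G.chromaticComplex j ⟶ G.matroidComplex j) (w : f ≫ g = 0)
          (h : (ShortComplex.mk f g w).ShortExact),
          (∀ i : ℤ, (LinearMap.range (f.f i).hom).map (G.chromaticCube.chain i j).subtype =
            (G.canonical.cube.chain i (j - 1)).map τ) ∧
          (∀ i : ℤ, (LinearMap.ker (g.f i).hom).map (G.chromaticCube.chain i j).subtype =
            G.chromaticCube.chain i j ⊓ LinearMap.ker G.theta) ∧
          ∀ i : ℤ,
            Function.Exact (HomologicalComplex.homologyMap f i).hom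
              (HomologicalComplex.homologyMap g i).hom ∧
            Function.Exact (HomologicalComplex.homologyMap g i).hom (h.δ i (i + 1) rfl).hom ∧
            Function.Exact (h.δ i (i + 1) rfl).hom
              (HomologicalComplex.homologyMap f (i + 1)).hom := by
  refine ⟨tau hG hv₀, isTau_tau hG hv₀, injective_tau hG hv₀, exact_tau_theta hG hv₀,
    surjective_theta hG hv₀, fun i j => ⟨?_, (map_theta_chain hG hv₀ i j).le⟩, fun j => ?_⟩
  · rw [map_tau_chain hG hv₀, ← map_range_rootedInclusion]
    exact Submodule.map_subtype_le _ _
  · obtain ⟨φ⟩ := nonempty_matroidComplex_iso hG hv₀ (j - 1)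
    obtain ⟨ψ⟩ := nonempty_matroidComplex_iso hG hv₀ j
    obtain ⟨f, g, w, h, hf, hg⟩ := exists_shortExact_of_iso (shortExact_rooted v₀ j) φ ψ.symm
    refine ⟨f, g, w, h, fun i => ?_, fun i => ?_, fun i => exact_homologyMap_δ h i (i + 1) rfl⟩
    · rw [hf, map_tau_chain hG hv₀]
      exact map_range_rootedInclusion v₀ i j
    · rw [hg]
      exact map_ker_rootedProjection hG hv₀ i j
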